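/- For every $\delta>0$ there are an $\varepsilon>0$ and a randomized polynomial-time algorithm with the following property. The input is a family $\mathcal S=(S_1,\dots,S_n)$ of $n$ subsets of a finite universe $U$, and the running time is at most a fixed polynomial in $n+|U|$, for every input and every outcome of the coin tosses. The algorithm always outputs a set $T\subseteq\{1,\dots,n\}$ of indices together with subsets $A_i\subseteq S_i$ $(i\in T)$ that are pairwise disjoint and satisfy $|A_i|\ge\varepsilon|S_i|$ for every $i\in T$. Whenever some $m$ sets of $\mathcal S$ form a partition of $U$ (that is, they are nonempty and pairwise disjoint, and their union is $U$), the number $|T|$ of sets found is at least $(1-\delta)m$ with probability at least $2/3$, and also $\mathbb E\,|T|\ge(1-\delta)m$. The number $m$ is not part of the input. (Algorithms are programs of a unit-cost random access machine with addition, truncated subtraction and fair coin tosses; the program and the polynomial depend only on $\delta$.) -/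

import Mathlib

open MeasureTheory

/-! ### A randomized random access machine with unit-cost steps

Registers and memory cells hold natural numbers.  The only arithmetic operations are addition and
truncated subtraction, so that `t` steps increase the bit length of the stored numbers by at most
`t` and the unit-cost step count is polynomially related to Turing machine time. -/

namespace RAM

/-- Programs.  `x y z` are names of registers and `a` is the name of a two-dimensional array; both
kinds of name are fixed in the program text, while the indices into an array are register contents.
-/
inductive Cmd : Type
  /-- `x := k` for a constant `k` -/
  | const (x k : ℕ)
  /-- `x := y + z` -/
  | add (x y z : ℕ)
  /-- `x := max (y - z) 0` -/
  | sub (x y z : ℕ)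
  /-- `x := a[y, z]` -/
  | load (x a y z : ℕ)
  /-- `a[y, z] := x` -/
  | store (a y z x : ℕ)
  /-- `x :=` the outcome (`0` or `1`) of the next coin toss -/
  | flip (x : ℕ)
  /-- do nothing -/
  | skip
  /-- first `c`, then `d` -/
  | seq (c d : Cmd)
  /-- if `x ≠ 0` then `c` else `d` -/
  | ite (x : ℕ) (c d : Cmd)
  /-- while `x ≠ 0` do `c` -/
  | loop (x : ℕ) (c : Cmd)

/-- The data of the machine: registers, arrays, and the coin tosses not yet used. -/
structure State : Type where
  reg : ℕ → ℕ
  mem : ℕ → ℕ → ℕ → ℕ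
  coins : ℕ → Bool

/-- Write `v` into register `x`. -/
def State.setReg (s : State) (x v : ℕ) : State :=
  { s with reg := Function.update s.reg x v }

/-- Write `v` into the cell `a[i, j]`. -/
def State.setMem (s : State) (a i j v : ℕ) : State :=
  { s with mem := fun a' i' j' => if a' = a ∧ i' = i ∧ j' = j then v else s.mem a' i' j' }

/-- A configuration: the commands still to be executed, in this order, and the data. -/
structure Cfg : Type where
  code : List Cmd
  state : State

/-- One step of the machine; a configuration with no command left has halted and is not changed. -/
def step : Cfg → Cfg
  | ⟨[], s⟩ => ⟨[], s⟩
  | ⟨.const x k :: r, s⟩ => ⟨r, s.setReg x k⟩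
  | ⟨.add x y z :: r, s⟩ => ⟨r, s.setReg x (s.reg y + s.reg z)⟩
  | ⟨.sub x y z :: r, s⟩ => ⟨r, s.setReg x (s.reg y - s.reg z)⟩
  | ⟨.load x a y z :: r, s⟩ => ⟨r, s.setReg x (s.mem a (s.reg y) (s.reg z))⟩
  | ⟨.store a y z x :: r, s⟩ => ⟨r, s.setMem a (s.reg y) (s.reg z) (s.reg x)⟩
  | ⟨.flip x :: r, s⟩ =>
      ⟨r, { s.setReg x (if s.coins 0 then 1 else 0) with coins := fun i => s.coins (i + 1) }⟩
  | ⟨.skip :: r, s⟩ => ⟨r, s⟩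
  | ⟨.seq c d :: r, s⟩ => ⟨c :: d :: r, s⟩
  | ⟨.ite x c d :: r, s⟩ => if s.reg x ≠ 0 then ⟨c :: r, s⟩ else ⟨d :: r, s⟩
  | ⟨.loop x c :: r, s⟩ => if s.reg x ≠ 0 then ⟨c :: .loop x c :: r, s⟩ else ⟨r, s⟩

/-- The configuration after `t` steps of the program `P` started on the data `s`. -/
def run (P : Cmd) (s : State) (t : ℕ) : Cfg := step^[t] ⟨[P], s⟩

/-- The law of an infinite sequence of independent fair coin tosses. -/
noncomputable def fairCoins : Measure (ℕ → Bool) :=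
  Measure.infinitePi fun _ => (PMF.uniformOfFintype Bool).toMeasure

end RAM

/-! ### Set packing

An instance is a family `S` of `n` sets over the universe `Fin N`. -/

namespace SetPacking

variable {n N : ℕ}

/-- The initial data on input `S` and coin tosses `ω`: `n` in register `0`, `N` in register `1`,
and the incidence matrix of the family in array `0`. -/
def input (S : Fin n → Finset (Fin N)) (ω : ℕ → Bool) : RAM.State where
  reg x := if x = 0 then n else if x = 1 then N else 0
  mem a i j := if a = 0 ∧ ∃ (hi : i < n) (hj : j < N), (⟨j, hj⟩ : Fin N) ∈ S ⟨i, hi⟩ then 1 else 0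
  coins := ω

/-- The data after `t` steps of the program `P` on input `S` with coin tosses `ω`. -/
def final (P : RAM.Cmd) (S : Fin n → Finset (Fin N)) (t : ℕ) (ω : ℕ → Bool) : RAM.State :=
  (RAM.run P (input S ω) t).state

/-- The indices of the selected sets, as read off the data `s`:
the `i` whose entry `[i, 0]` in array `1` is not zero. -/
def selected (n : ℕ) (s : RAM.State) : Finset (Fin n) := {i | s.mem 1 i 0 ≠ 0}

/-- The subset `A i`, as read off the data `s`:
the `j` whose entry `[i, j]` in array `2` is not zero. -/
def part (N : ℕ) (s : RAM.State) (i : ℕ) : Finset (Fin N) := {j | s.mem 2 i j ≠ 0}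

/-- Some `m` sets of the family form a partition of the universe: they are nonempty and pairwise
disjoint, and they cover everything. -/
def HasPartition (S : Fin n → Finset (Fin N)) (m : ℕ) : Prop :=
  ∃ I : Finset (Fin n), I.card = m ∧ (∀ i ∈ I, (S i).Nonempty) ∧
    (I : Set (Fin n)).PairwiseDisjoint S ∧ I.biUnion S = Finset.univ

/-- The sets `S i`, `i ∈ T`, together with the subsets `A i` form an `ε`-partial packing. -/
def IsPartialPacking (S : Fin n → Finset (Fin N)) (ε : ℝ) (T : Finset (Fin n))
    (A : Fin n → Finset (Fin N)) : Prop :=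
  (∀ i ∈ T, A i ⊆ S i ∧ ε * ((S i).card : ℝ) ≤ ((A i).card : ℝ)) ∧
    (T : Set (Fin n)).PairwiseDisjoint A

end SetPacking

/-!
The algorithm is deterministic. Let `B > 2 / δ` and `K = 2 * (B + 1)`.

The sets of size at most `K` take part in an auction: a set that holds nothing buys its cheapest
element, possibly from its current owner, for one unit more than the present price, as long as that
price is less than `B`. The sum of the prices increases, so the auction ends. Prices and surpluses
are then an almost optimal dual solution of the matching problem between the sets and the elements:
among the small sets of a disjoint family, at least a `B / (B + 1)` fraction as many have been
served. One element is a `1 / K` fraction of a small set.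

The larger sets are treated in the order of their sizes. A set takes a `1 / K` fraction of its
elements if so many of them are free. If not, almost all of its elements have been taken by sets
that are not larger, and a set takes little more than a `1 / K` fraction of itself. Counting the
taken elements, each weighted by the reciprocal of the number of elements that its owner took, a
disjoint family contains few such blocked sets compared with the sets that were served.
-/

namespace SetPacking

open Finset

/-- An allocation of elements to sets, as kept by the auction and by the greedy choice: `owner j` is
the index of the set that has received the element `j`.  An element of price `0` is free, and its
owner is meaningless. -/
@[ext]
structure Alloc (ι α : Type*) where
  owner : α → ι
  price : α → ℕ

namespace Alloc

variable {ι α : Type*} {E : ι → Finset α} {K B : ℕ} {a a' : Alloc ι α} {i : ι} {U : Finset α}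

/-- The allocation after the elements of `A` have been given to the set number `i` at price `p`. -/
def give [DecidableEq α] (a : Alloc ι α) (i : ι) (A : Finset α) (p : ℕ) : Alloc ι α where
  owner j := if j ∈ A then i else a.owner j
  price j := if j ∈ A then p else a.price j

/-- Every element that is not free has been given to a set containing it. -/
def Valid (a : Alloc ι α) (E : ι → Finset α) : Prop := ∀ j, a.price j ≠ 0 → j ∈ E (a.owner j)

theorem sum_price_give_singleton [DecidableEq α] {j : α} (hj : j ∈ U) :
    ∑ l ∈ U, (a.give i {j} (a.price j + 1)).price l = ∑ l ∈ U, a.price l + 1 := by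
  rw [← add_sum_erase _ _ hj, ← add_sum_erase U a.price hj,
    sum_congr rfl (g := a.price) fun l hl => by simp [give, ne_of_mem_erase hl]]
  simp only [give, mem_singleton, if_true]
  ring

section Basic

variable [DecidableEq ι]

/-- The elements of `E i` that have been given to the set number `i`. -/
def part (a : Alloc ι α) (E : ι → Finset α) (i : ι) : Finset α :=
  {j ∈ E i | a.price j ≠ 0 ∧ a.owner j = i}

/-- The indices of the sets that have received an element of `U`. -/
def winners (a : Alloc ι α) (U : Finset α) : Finset ι := image a.owner {j ∈ U | a.price j ≠ 0}

theorem mem_part {j : α} : j ∈ a.part E i ↔ j ∈ E i ∧ a.price j ≠ 0 ∧ a.owner j = i :=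
  mem_filter

theorem Valid.mem_part (h : a.Valid E) {j : α} : j ∈ a.part E i ↔ a.price j ≠ 0 ∧ a.owner j = i :=
  Alloc.mem_part.trans <| and_iff_right_of_imp fun ⟨hj, hi⟩ => hi ▸ h j hj

theorem Valid.mem_winners (h : a.Valid E) {U : Finset α} (hU : ∀ i, E i ⊆ U) :
    i ∈ a.winners U ↔ (a.part E i).Nonempty := by
  simp only [winners, mem_image, mem_filter, Finset.Nonempty, h.mem_part]
  exact exists_congr fun j => and_congr_left fun _ =>
    and_iff_right_of_imp fun hj => hU _ (h j hj)

end Basic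

/-! ### The auction -/

section Auction

variable [DecidableEq ι]

/-- The invariant of an auction with prices at most `B` for the sets of size at most `K`: no set
holds two elements, and the element a set holds is its cheapest one up to one unit. -/
structure AuctionInv (E : ι → Finset α) (K B : ℕ) (a : Alloc ι α) : Prop where
  valid : a.Valid E
  small : ∀ j, a.price j ≠ 0 → #(E (a.owner j)) ≤ K
  inj : Set.InjOn a.owner {j | a.price j ≠ 0}
  min : ∀ j, a.price j ≠ 0 → ∀ j' ∈ E (a.owner j), a.price j ≤ a.price j' + 1
  le : ∀ j, a.price j ≤ B

/-- In the auction, the set number `i` is small, holds nothing, and can afford the element `j`,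
which is one of its cheapest. -/
structure Wants (E : ι → Finset α) (K B : ℕ) (a : Alloc ι α) (i : ι) (j : α) : Prop where
  small : #(E i) ≤ K
  part_eq : a.part E i = ∅
  mem : j ∈ E i
  lt : a.price j < B
  min : ∀ j' ∈ E i, a.price j ≤ a.price j'

theorem AuctionInv.buy [DecidableEq α] {j : α} (h : AuctionInv E K B a) (hw : Wants E K B a i j) :
    AuctionInv E K B (a.give i {j} (a.price j + 1)) := by
  have howner : ∀ l, a.price l ≠ 0 → a.owner l ≠ i := fun l hl hi =>
    notMem_empty l (hw.part_eq ▸ h.valid.mem_part.2 ⟨hl, hi⟩)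
  obtain ⟨hsmall, -, hmem, hlt, hmin⟩ := hw
  constructor <;> simp only [Valid, Set.InjOn, Set.mem_ofPred_eq, give, mem_singleton] <;> intro l
  · have := h.valid l
    grind
  · have := h.small l
    grind
  · intro hl l' hl' heq
    have hinj : a.price l ≠ 0 → a.price l' ≠ 0 → a.owner l = a.owner l' → l = l' :=
      fun h0 h0' => h.inj h0 h0'
    grind
  · intro hl l' hl'
    have := h.min l
    have := hmin l'
    grind
  · have := h.le l
    grind

theorem AuctionInv.card_winners (h : AuctionInv E K B a) (U : Finset α) :
    #(a.winners U) = #{j ∈ U | a.price j ≠ 0} :=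
  card_image_of_injOn fun _ hj _ hj' => h.inj (mem_filter.1 hj).2 (mem_filter.1 hj').2

theorem AuctionInv.le_price_add_sum (h : AuctionInv E K B a) (hU : ∀ i, E i ⊆ U)
    (hsmall : #(E i) ≤ K) (hcontent : ∀ j, ¬ Wants E K B a i j) {l : α} (hl : l ∈ E i) :
    B ≤ a.price l + ∑ j ∈ U with a.price j ≠ 0 ∧ a.owner j = i, (B + 1 - a.price j) := by
  obtain hempty | ⟨j, hj⟩ := (a.part E i).eq_empty_or_nonempty
  · obtain ⟨j, hj, hmin⟩ := exists_min_image (E i) a.price ⟨l, hl⟩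
    have hle : B ≤ a.price j := not_lt.1 fun hlt => hcontent j ⟨hsmall, hempty, hj, hlt, hmin⟩
    exact (hle.trans (hmin l hl)).trans (Nat.le_add_right _ _)
  · obtain ⟨hjE, hj0, rfl⟩ := mem_part.1 hj
    have hmin := h.min j hj0 l hl
    have hterm := single_le_sum (f := fun j => B + 1 - a.price j) (fun _ _ => Nat.zero_le _)
      (mem_filter.2 ⟨hU _ hjE, hj0, rfl⟩ :
        j ∈ {j' ∈ U | a.price j' ≠ 0 ∧ a.owner j' = a.owner j})
    omega

/-- Weak duality: the prices `a.price j` and the surpluses `B + 1 - a.price j` of the winners form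
an almost feasible dual solution of value `(B + 1) * #(a.winners U)`. -/
theorem AuctionInv.mul_card_le (h : AuctionInv E K B a) (hU : ∀ i, E i ⊆ U) {I : Finset ι}
    (hcontent : ∀ i ∈ I, ∀ j, ¬ Wants E K B a i j) (hsmall : ∀ i ∈ I, #(E i) ≤ K)
    (hne : ∀ i ∈ I, (E i).Nonempty) (hdisj : (I : Set ι).PairwiseDisjoint E) :
    B * #I ≤ (B + 1) * #(a.winners U) := by
  classical
  obtain rfl | ⟨i₀, hi₀⟩ := I.eq_empty_or_nonempty
  · simp
  have : Nonempty α := (hne i₀ hi₀).to_type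
  choose! f hf using hne
  have hinj : Set.InjOn f I := fun i hi i' hi' heq => by
    by_contra hii'
    exact disjoint_left.1 (hdisj hi hi' hii') (hf i hi) (heq ▸ hf i' hi')
  set H : Finset α := {j ∈ U | a.price j ≠ 0} with hH
  have hprice : ∑ i ∈ I, a.price (f i) ≤ ∑ j ∈ H, a.price j := by
    rw [← sum_image (f := a.price) hinj]
    exact sum_le_sum_of_ne_zero fun j _ hj => mem_filter.2 ⟨hU _ (h.valid j hj), hj⟩
  have hsurplus : ∑ i ∈ I, ∑ j ∈ H with a.owner j = i, (B + 1 - a.price j) ≤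
      ∑ j ∈ H, (B + 1 - a.price j) := by
    rw [sum_fiberwise_eq_sum_filter]
    exact sum_le_sum_of_subset (filter_subset _ _)
  calc B * #I ≤ ∑ i ∈ I, (a.price (f i) + ∑ j ∈ H with a.owner j = i, (B + 1 - a.price j)) := by
        rw [mul_comm, ← smul_eq_mul]
        refine card_nsmul_le_sum _ _ _ fun i hi => ?_
        rw [hH, filter_filter]
        exact h.le_price_add_sum hU (hsmall i hi) (hcontent i hi) (hf i hi)
    _ ≤ ∑ j ∈ H, a.price j + ∑ j ∈ H, (B + 1 - a.price j) := by
        rw [sum_add_distrib]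
        exact add_le_add hprice hsurplus
    _ = (B + 1) * #(a.winners U) := by
        rw [h.card_winners, ← sum_add_distrib,
          sum_congr rfl fun j _ => Nat.add_sub_of_le ((h.le j).trans B.le_succ), sum_const,
          smul_eq_mul, mul_comm]

end Auction

/-! ### The greedy choice -/

section Greedy

/-- The greedy choice treats the set number `i`: it receives about a `1 / K` fraction of itself, as
far as there are enough free elements. -/
inductive GreedyStep [DecidableEq α] (E : ι → Finset α) (K : ℕ) (a : Alloc ι α) (i : ι) :
    Alloc ι α → Prop
  | reject (hfew : K * #{j ∈ E i | a.price j = 0} < #(E i)) : GreedyStep E K a i a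
  | accept (A : Finset α) (hA : A ⊆ {j ∈ E i | a.price j = 0}) (hle : #(E i) ≤ K * #A)
      (hlt : K * #A < #(E i) + K) : GreedyStep E K a i (a.give i A 1)

/-- All but a `1 / K` fraction of the set number `i` is held by sets that are not larger. -/
def Blocked (E : ι → Finset α) (K : ℕ) (a : Alloc ι α) (i : ι) : Prop :=
  K * #{j ∈ E i | a.price j = 0 ∨ #(E i) < #(E (a.owner j))} < #(E i)

theorem Blocked.give [DecidableEq α] {A : Finset α} {k : ι} (h : Blocked E K a k)
    (hA : A ⊆ {j ∈ E i | a.price j = 0}) : Blocked E K (a.give i A 1) k := by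
  refine (Nat.mul_le_mul_left K (card_le_card ?_)).trans_lt h
  refine monotone_filter_right _ fun j _ hj => ?_
  have hjA := @hA j
  simp only [Alloc.give, mem_filter] at hjA hj
  grind

variable [DecidableEq ι] {T : Finset ι} {D : Set ι}

/-- The invariant of the greedy choice; `D` is the family of the sets already treated, and `T` is
the family of the small sets that hold an element after the auction. -/
structure GreedyInv (E : ι → Finset α) (K : ℕ) (T : Finset ι) (D : Set ι) (a : Alloc ι α) :
    Prop where
  valid : a.Valid E
  card_le : ∀ i, (a.part E i).Nonempty → #(E i) ≤ K * #(a.part E i)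
  card_lt : ∀ i, (a.part E i).Nonempty → K * #(a.part E i) < #(E i) + K
  auction : ∀ i ∈ T, (a.part E i).Nonempty
  treated : ∀ j, a.price j ≠ 0 → a.owner j ∈ D
  settled : ∀ i ∈ D, K < #(E i) → (a.part E i).Nonempty ∨ Blocked E K a i

theorem AuctionInv.greedyInv (h : AuctionInv E K B a) (hU : ∀ i, E i ⊆ U) :
    GreedyInv E K (a.winners U) {i | #(E i) < K + 1} a := by
  have hone : ∀ i, (a.part E i).Nonempty → #(a.part E i) = 1 ∧ #(E i) ≤ K ∧ 0 < #(E i) := by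
    rintro i ⟨j, hj⟩
    obtain ⟨hjE, hj0, rfl⟩ := mem_part.1 hj
    refine ⟨card_eq_one.2 ⟨j, eq_singleton_iff_unique_mem.2 ⟨hj, fun l hl => ?_⟩⟩,
      h.small j hj0, card_pos.2 ⟨j, hjE⟩⟩
    obtain ⟨-, hl0, hl⟩ := mem_part.1 hl
    exact h.inj hl0 hj0 hl
  refine ⟨h.valid, fun i hi => ?_, fun i hi => ?_, fun i hi => (h.valid.mem_winners hU).1 hi,
    fun j hj => Nat.lt_succ_of_le (h.small j hj), fun i hi hlarge => ?_⟩
  · rw [(hone i hi).1, mul_one]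
    exact (hone i hi).2.1
  · rw [(hone i hi).1, mul_one]
    exact Nat.lt_add_of_pos_left (hone i hi).2.2
  · exact absurd (Nat.lt_succ_iff.1 hi) (not_le.2 hlarge)

theorem GreedyInv.part_eq_empty (h : GreedyInv E K T D a) (hi : i ∉ D) : a.part E i = ∅ :=
  eq_empty_of_forall_notMem fun j hj => by
    obtain ⟨-, hj0, rfl⟩ := mem_part.1 hj
    exact hi (h.treated j hj0)

theorem GreedyInv.blocked (h : GreedyInv E K T D a) (hD : ∀ t ∈ D, #(E t) ≤ #(E i))
    (hfew : K * #{j ∈ E i | a.price j = 0} < #(E i)) : Blocked E K a i := by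
  have hiff : ∀ j ∈ E i, (a.price j = 0 ∨ #(E i) < #(E (a.owner j))) ↔ a.price j = 0 := by
    intro j _
    by_cases hj : a.price j = 0
    · simp [hj]
    · simpa [hj] using hD _ (h.treated j hj)
  rwa [Blocked, filter_congr hiff]

/-- The share of the element `j` in the charging argument: every winner distributes one unit evenly
among the elements it holds. -/
def weight (E : ι → Finset α) (a : Alloc ι α) (j : α) : ℚ :=
  if a.price j = 0 then 0 else (#(a.part E (a.owner j)) : ℚ)⁻¹

theorem weight_nonneg (j : α) : 0 ≤ a.weight E j := by
  unfold weight
  split_ifs <;> positivity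

theorem Valid.sum_weight_le (h : a.Valid E) (S U : Finset α) (hU : ∀ i, E i ⊆ U) :
    ∑ j ∈ S, a.weight E j ≤ #(a.winners U) := by
  set H : Finset α := {j ∈ U | a.price j ≠ 0} with hH
  have hfiber : ∀ i, #{j ∈ H | a.owner j = i} = #(a.part E i) := fun i => by
    congr 1
    ext j
    simp only [hH, mem_filter, h.mem_part, and_assoc]
    exact and_iff_right_of_imp fun hj => hU _ (h j hj.1)
  have hzero : ∀ j ∈ S, a.weight E j ≠ 0 → a.price j ≠ 0 := fun j _ hj hj0 => hj (if_pos hj0)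
  have hsub : {j ∈ S | a.price j ≠ 0} ⊆ H := fun j hj =>
    mem_filter.2 ⟨hU _ (h j (mem_filter.1 hj).2), (mem_filter.1 hj).2⟩
  calc ∑ j ∈ S, a.weight E j = ∑ j ∈ S with a.price j ≠ 0, a.weight E j :=
        (sum_filter_of_ne hzero).symm
    _ ≤ ∑ j ∈ H, a.weight E j :=
        sum_le_sum_of_subset_of_nonneg hsub fun j _ _ => weight_nonneg j
    _ = ∑ i ∈ a.winners U, ∑ j ∈ H with a.owner j = i, a.weight E j :=
        (sum_fiberwise_of_maps_to (fun j hj => mem_image_of_mem _ hj) _).symm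
    _ ≤ ∑ i ∈ a.winners U, 1 := sum_le_sum fun i _ => by
        rw [sum_congr rfl (g := fun _ => (#(a.part E i) : ℚ)⁻¹), sum_const, hfiber, nsmul_eq_mul]
        · exact mul_inv_le_one
        · intro j hj
          simp only [hH, mem_filter] at hj
          rw [weight, if_neg hj.1.2, hj.2]
    _ = #(a.winners U) := by simp

/-- With `K = 2 * (B + 1)`, an owner of an element of `E i` that is not larger than `E i` holds at
most `#(E i) / (B + 1)` elements, so each of these elements carries weight `(B + 1) / #(E i)`. -/
theorem GreedyInv.le_sum_weight (h : GreedyInv E (2 * (B + 1)) T D a)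
    (hlarge : 2 * (B + 1) < #(E i)) (hblocked : Blocked E (2 * (B + 1)) a i) :
    (B : ℚ) ≤ ∑ j ∈ E i, a.weight E j := by
  set O : Finset α := {j ∈ E i | ¬ (a.price j = 0 ∨ #(E i) < #(E (a.owner j)))} with hO
  have hpos : (0 : ℚ) < #(E i) := by exact_mod_cast (Nat.zero_le _).trans_lt hlarge
  have hcard : B * #(E i) ≤ #O * (B + 1) := by
    have hsplit := card_filter_add_card_filter_not (s := E i)
      fun j => a.price j = 0 ∨ #(E i) < #(E (a.owner j))
    rw [← hO] at hsplit
    unfold Blocked at hblocked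
    nlinarith
  have hweight : ∀ j ∈ O, ((B + 1 : ℕ) : ℚ) / #(E i) ≤ a.weight E j := by
    intro j hj
    obtain ⟨-, hj⟩ := mem_filter.1 hj
    obtain ⟨hj0, hle⟩ := not_or.1 hj
    have hpart : (a.part E (a.owner j)).Nonempty := ⟨j, h.valid.mem_part.2 ⟨hj0, rfl⟩⟩
    have hlt := h.card_lt _ hpart
    have hshare : (B + 1) * #(a.part E (a.owner j)) ≤ #(E i) := by linarith
    rw [weight, if_neg hj0, div_le_iff₀ hpos, inv_mul_eq_div,
      le_div_iff₀ (by exact_mod_cast hpart.card_pos)]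
    exact_mod_cast hshare
  calc (B : ℚ) ≤ #O * (((B + 1 : ℕ) : ℚ) / #(E i)) := by
        rw [mul_div_assoc', le_div_iff₀ hpos]
        exact_mod_cast hcard
    _ ≤ ∑ j ∈ O, a.weight E j := by
        rw [← nsmul_eq_mul]
        exact card_nsmul_le_sum _ _ _ hweight
    _ ≤ ∑ j ∈ E i, a.weight E j :=
        sum_le_sum_of_subset_of_nonneg (filter_subset _ _) fun j _ _ => weight_nonneg j

theorem GreedyInv.mul_card_blocked_le (h : GreedyInv E (2 * (B + 1)) T D a) (hU : ∀ i, E i ⊆ U)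
    {R : Finset ι} (hlarge : ∀ i ∈ R, 2 * (B + 1) < #(E i))
    (hblocked : ∀ i ∈ R, Blocked E (2 * (B + 1)) a i) (hdisj : (R : Set ι).PairwiseDisjoint E) :
    B * #R ≤ #(a.winners U) := by
  classical
  have hsum : (#R * B : ℚ) ≤ #(a.winners U) :=
    calc (#R * B : ℚ) ≤ ∑ i ∈ R, ∑ j ∈ E i, a.weight E j := by
          rw [← nsmul_eq_mul]
          exact card_nsmul_le_sum _ _ _ fun i hi => h.le_sum_weight (hlarge i hi) (hblocked i hi)
      _ = ∑ j ∈ R.biUnion E, a.weight E j := (sum_biUnion hdisj).symm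
      _ ≤ #(a.winners U) := h.valid.sum_weight_le _ U hU
  rw [mul_comm]
  exact_mod_cast hsum

theorem GreedyInv.mul_card_le (h : GreedyInv E (2 * (B + 1)) T Set.univ a) (hU : ∀ i, E i ⊆ U)
    {I : Finset ι} (hdisj : (I : Set ι).PairwiseDisjoint E)
    (hTsmall : ∀ i ∈ T, #(E i) ≤ 2 * (B + 1))
    (hT : B * #{i ∈ I | #(E i) ≤ 2 * (B + 1)} ≤ (B + 1) * #T) :
    B * #I ≤ (B + 2) * #(a.winners U) := by
  set L : Finset ι := {i ∈ I | ¬ #(E i) ≤ 2 * (B + 1)} with hL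
  have hI := card_filter_add_card_filter_not (s := I) fun i => #(E i) ≤ 2 * (B + 1)
  have hLsplit := card_filter_add_card_filter_not (s := L) fun i => (a.part E i).Nonempty
  have hlarge : ∀ i ∈ L, 2 * (B + 1) < #(E i) := fun i hi => not_le.1 (mem_filter.1 hi).2
  have hlost : B * #{i ∈ L | ¬ (a.part E i).Nonempty} ≤ #(a.winners U) := by
    refine h.mul_card_blocked_le hU (fun i hi => hlarge i (mem_filter.1 hi).1) (fun i hi => ?_)
      (hdisj.subset fun i hi => (mem_filter.1 (mem_filter.1 hi).1).1)
    obtain ⟨hiL, hi⟩ := mem_filter.1 hi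
    exact (h.settled i trivial (hlarge i hiL)).resolve_left hi
  have hwon : #T + #{i ∈ L | (a.part E i).Nonempty} ≤ #(a.winners U) := by
    rw [← card_union_of_disjoint]
    · refine card_le_card fun i hi => (h.valid.mem_winners hU).2 ?_
      exact (mem_union.1 hi).elim (h.auction i) fun hi => (mem_filter.1 hi).2
    · exact disjoint_left.2 fun i hi hi' =>
        (hlarge i (mem_filter.1 hi').1).not_ge (hTsmall i hi)
  rw [← hL] at hI
  nlinarith

/-- The properties of the computed allocation: every set that receives elements receives a `1 / K`
fraction of itself, and the number of these sets is almost that of any disjoint subfamily. -/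
structure NearOptimal (E : ι → Finset α) (K B : ℕ) (U : Finset α) (a : Alloc ι α) : Prop where
  valid : a.Valid E
  card_le : ∀ i ∈ a.winners U, #(E i) ≤ K * #(a.part E i)
  mul_card_le : ∀ I : Finset ι, (∀ i ∈ I, (E i).Nonempty) → (I : Set ι).PairwiseDisjoint E →
    B * #I ≤ (B + 2) * #(a.winners U)

theorem GreedyInv.nearOptimal {a₀ : Alloc ι α}
    (h : GreedyInv E (2 * (B + 1)) (a₀.winners U) Set.univ a)
    (h₀ : AuctionInv E (2 * (B + 1)) B a₀) (hcontent : ∀ i j, ¬ Wants E (2 * (B + 1)) B a₀ i j)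
    (hU : ∀ i, E i ⊆ U) : NearOptimal E (2 * (B + 1)) B U a where
  valid := h.valid
  card_le i hi := h.card_le i ((h.valid.mem_winners hU).1 hi)
  mul_card_le I hne hdisj := by
    refine h.mul_card_le hU hdisj (fun i hi => ?_) ?_
    · obtain ⟨j, hj, rfl⟩ := mem_image.1 hi
      exact h₀.small j (mem_filter.1 hj).2
    · exact h₀.mul_card_le hU (fun i _ => hcontent i) (fun i hi => (mem_filter.1 hi).2)
        (fun i hi => hne i (mem_filter.1 hi).1) (hdisj.subset (filter_subset _ I))

variable [DecidableEq α]

theorem part_give {A : Finset α} (hA : A ⊆ {j ∈ E i | a.price j = 0}) (hi : a.part E i = ∅)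
    (k : ι) : (a.give i A 1).part E k = if k = i then A else a.part E k := by
  ext j
  have hjA := @hA j
  have hj : j ∉ a.part E i := hi ▸ notMem_empty j
  simp only [mem_filter, mem_part] at hjA hj
  split_ifs <;> simp only [part, give, mem_filter] <;> grind

theorem GreedyInv.step (h : GreedyInv E K T D a) (hi : i ∉ D) (hD : ∀ t ∈ D, #(E t) ≤ #(E i))
    (hlarge : K < #(E i)) (hstep : GreedyStep E K a i a') :
    GreedyInv E K T (insert i D) a' := by
  cases hstep with
  | reject hfew =>
    refine { h with treated := fun j hj => Or.inr (h.treated j hj), settled := ?_ }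
    rintro k (rfl | hk) hlarge
    · exact .inr (h.blocked hD hfew)
    · exact h.settled k hk hlarge
  | accept A hA hle hlt =>
    have hpart := part_give hA (h.part_eq_empty hi)
    have hAne : A.Nonempty := card_pos.1 (Nat.pos_of_mul_pos_left (by omega : 0 < K * #A))
    have hne : ∀ k, (a.part E k).Nonempty → ((a.give i A 1).part E k).Nonempty := fun k hk => by
      rw [hpart]
      split_ifs
      exacts [hAne, hk]
    refine ⟨fun j hj => ?_, fun k hk => ?_, fun k hk => ?_, fun k hk => hne k (h.auction k hk),
      fun j hj => ?_, fun k hk hlarge => ?_⟩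
    · have hjA := @hA j
      have hval := h.valid j
      simp only [Alloc.give, mem_filter] at hj hjA ⊢
      grind
    · rw [hpart] at hk ⊢
      split_ifs at hk ⊢ with hki
      exacts [hki ▸ hle, h.card_le k hk]
    · rw [hpart] at hk ⊢
      split_ifs at hk ⊢ with hki
      exacts [hki ▸ hlt, h.card_lt k hk]
    · simp only [Alloc.give] at hj ⊢
      split_ifs at hj ⊢
      exacts [Set.mem_insert _ _, Set.mem_insert_of_mem _ (h.treated j hj)]
    · obtain rfl | hki := eq_or_ne k i
      · exact .inl (by rwa [hpart, if_pos rfl])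
      · exact (h.settled k (hk.resolve_left hki) hlarge).imp (hne k) fun hb => hb.give hA

end Greedy

end Alloc

end SetPacking

namespace RAM

instance : IsProbabilityMeasure fairCoins :=
  inferInstanceAs (IsProbabilityMeasure (Measure.infinitePi _))

infixr:60 " ;; " => Cmd.seq

section Machine

variable {s : State} {x y a a' i i' j j' v : ℕ}

@[simp]
theorem State.reg_setReg : (s.setReg x v).reg y = if y = x then v else s.reg y :=
  Function.update_apply ..

@[simp]
theorem State.mem_setReg : (s.setReg x v).mem = s.mem := rfl

@[simp]
theorem State.reg_setMem : (s.setMem a i j v).reg = s.reg := rfl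

@[simp]
theorem State.mem_setMem :
    (s.setMem a i j v).mem a' i' j' = if a' = a ∧ i' = i ∧ j' = j then v else s.mem a' i' j' := rfl

theorem iterate_step_of_code_eq_nil {C : Cfg} (h : C.code = []) (t : ℕ) : step^[t] C = C := by
  obtain ⟨_, s⟩ := C
  cases h
  exact Function.iterate_fixed rfl t

end Machine

/-! ### Total correctness with a time bound -/

/-- A bound on the running time of a program in which no execution of a loop takes more than `M`
rounds.  The semiring is `ℕ` for numbers of steps and `Polynomial ℕ` for polynomial bounds. -/
def Cmd.time {R : Type*} [Semiring R] (M : R) : Cmd → R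
  | .seq c d => c.time M + d.time M + 1
  | .ite _ c d => c.time M + d.time M + 1
  | .loop _ c => M * (c.time M + 1) + 1
  | _ => 1

theorem Cmd.map_time {R R' : Type*} [Semiring R] [Semiring R'] (f : R →+* R') (M : R) (c : Cmd) :
    f (c.time M) = c.time (f M) := by
  induction c <;> simp_all [Cmd.time]

/-- The weakest precondition of `c` for the postcondition `Q`: started on the data `s`, the command
`c` ends after at most `c.time M` steps and without a coin toss, and the data then satisfy `Q`. -/
def WP (M : ℕ) (c : Cmd) (s : State) (Q : State → Prop) : Prop :=
  ∃ t ≤ c.time M, ∃ s', Q s' ∧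
    ∀ r ω, step^[t] ⟨c :: r, { s with coins := ω }⟩ = ⟨r, { s' with coins := ω }⟩

namespace WP

variable {M x y z a k : ℕ} {b c d : Cmd} {s : State} {Q Q' : State → Prop}

theorem mono (h : WP M c s Q) (hQ : ∀ s', Q s' → Q' s') : WP M c s Q' :=
  let ⟨t, ht, s', hs', hrun⟩ := h
  ⟨t, ht, s', hQ s' hs', hrun⟩

theorem const (h : Q (s.setReg x k)) : WP M (.const x k) s Q :=
  ⟨1, le_rfl, _, h, fun _ _ => rfl⟩

theorem add (h : Q (s.setReg x (s.reg y + s.reg z))) : WP M (.add x y z) s Q :=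
  ⟨1, le_rfl, _, h, fun _ _ => rfl⟩

theorem sub (h : Q (s.setReg x (s.reg y - s.reg z))) : WP M (.sub x y z) s Q :=
  ⟨1, le_rfl, _, h, fun _ _ => rfl⟩

theorem load (h : Q (s.setReg x (s.mem a (s.reg y) (s.reg z)))) : WP M (.load x a y z) s Q :=
  ⟨1, le_rfl, _, h, fun _ _ => rfl⟩

theorem store (h : Q (s.setMem a (s.reg y) (s.reg z) (s.reg x))) : WP M (.store a y z x) s Q :=
  ⟨1, le_rfl, _, h, fun _ _ => rfl⟩

theorem skip (h : Q s) : WP M .skip s Q :=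
  ⟨1, le_rfl, _, h, fun _ _ => rfl⟩

theorem seq (h : WP M c s fun s' => WP M d s' Q) : WP M (c ;; d) s Q := by
  obtain ⟨t, ht, s', ⟨t', ht', s'', hQ, hd⟩, hc⟩ := h
  refine ⟨t' + t + 1, by simp only [Cmd.time]; omega, s'', hQ, fun r ω => ?_⟩
  rw [Function.iterate_succ_apply, Function.iterate_add_apply]
  exact (congrArg _ (hc (d :: r) ω)).trans (hd r ω)

theorem ite (ht : s.reg x ≠ 0 → WP M c s Q) (he : s.reg x = 0 → WP M d s Q) :
    WP M (.ite x c d) s Q := by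
  by_cases hx : s.reg x = 0
  · obtain ⟨t, ht, s', hQ, hrun⟩ := he hx
    refine ⟨t + 1, by simp only [Cmd.time]; omega, s', hQ, fun r ω => ?_⟩
    rw [Function.iterate_succ_apply, step, if_neg (not_not.2 hx), hrun]
  · obtain ⟨t, ht, s', hQ, hrun⟩ := ht hx
    refine ⟨t + 1, by simp only [Cmd.time]; omega, s', hQ, fun r ω => ?_⟩
    rw [Function.iterate_succ_apply, step, if_pos hx, hrun]

theorem loop (Inv : State → Prop) (V : State → ℕ) (h : Inv s) (hV : V s ≤ M)
    (hbody : ∀ s', Inv s' → s'.reg x ≠ 0 → WP M c s' fun s'' => Inv s'' ∧ V s'' < V s') :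
    WP M (.loop x c) s fun s' => Inv s' ∧ s'.reg x = 0 := by
  suffices H : ∃ t ≤ V s * (c.time M + 1) + 1, ∃ s', (Inv s' ∧ s'.reg x = 0) ∧ ∀ r ω,
      step^[t] ⟨.loop x c :: r, { s with coins := ω }⟩ = ⟨r, { s' with coins := ω }⟩ by
    obtain ⟨t, ht, hs'⟩ := H
    exact ⟨t, ht.trans (Nat.succ_le_succ (Nat.mul_le_mul_right _ hV)), hs'⟩
  clear hV
  induction hv : V s using Nat.strong_induction_on generalizing s with
  | _ v ih =>
    by_cases hx : s.reg x = 0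
    · exact ⟨1, Nat.le_add_left .., s, ⟨h, hx⟩, fun r ω => by simp [step, hx]⟩
    · obtain ⟨t, ht, s', ⟨h', hlt⟩, hrun⟩ := hbody s h hx
      obtain ⟨t', ht', s'', hs'', hrun'⟩ := ih (V s') (hv ▸ hlt) h' rfl
      refine ⟨t' + t + 1, by nlinarith, s'', hs'', fun r ω => ?_⟩
      rw [Function.iterate_succ_apply, Function.iterate_add_apply, step, if_pos hx, hrun, hrun']

theorem run (h : WP M c s Q) :
    ∃ s', Q s' ∧ ∀ ω, run c { s with coins := ω } (c.time M) = ⟨[], { s' with coins := ω }⟩ := by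
  obtain ⟨t, ht, s', hQ, hrun⟩ := h
  refine ⟨s', hQ, fun ω => ?_⟩
  rw [RAM.run, ← Nat.sub_add_cancel ht, Function.iterate_add_apply, hrun,
    iterate_step_of_code_eq_nil rfl]

end WP

/-! ### Registers and arrays left alone by a command -/

/-- The registers that a command may change. -/
def Cmd.writes : Cmd → Finset ℕ
  | .const x _ | .add x _ _ | .sub x _ _ | .load x _ _ _ | .flip x => {x}
  | .store .. | .skip => ∅
  | .seq c d | .ite _ c d => c.writes ∪ d.writes
  | .loop _ c => c.writes

/-- The arrays that a command may change. -/
def Cmd.stores : Cmd → Finset ℕ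
  | .store a _ _ _ => {a}
  | .seq c d | .ite _ c d => c.stores ∪ d.stores
  | .loop _ c => c.stores
  | _ => ∅

/-- The data `s'` differ from `s` only where the command `c` may change them. -/
structure Frame (c : Cmd) (s s' : State) : Prop where
  reg : ∀ x ∉ c.writes, s'.reg x = s.reg x
  mem : ∀ a ∉ c.stores, s'.mem a = s.mem a

namespace Frame

variable {b c : Cmd} {s s' s'' : State} {x v : ℕ}

theorem refl (c : Cmd) (s : State) : Frame c s s :=
  ⟨fun _ _ => rfl, fun _ _ => rfl⟩

theorem trans (h : Frame c s s') (h' : Frame b s' s'') (hw : b.writes ⊆ c.writes)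
    (hs : b.stores ⊆ c.stores) : Frame c s s'' :=
  ⟨fun x hx => (h'.reg x fun hb => hx (hw hb)).trans (h.reg x hx),
    fun a ha => (h'.mem a fun hb => ha (hs hb)).trans (h.mem a ha)⟩

theorem setReg (h : Frame c s s') (hx : x ∈ c.writes) : Frame c s (s'.setReg x v) :=
  ⟨fun y hy => by
    have hyx : y ≠ x := fun hyx => hy (hyx ▸ hx)
    rw [State.reg_setReg, if_neg hyx]
    exact h.reg y hy, h.mem⟩

end Frame

theorem step_frame {W A : Finset ℕ} {C : Cfg} (h : ∀ c ∈ C.code, c.writes ⊆ W ∧ c.stores ⊆ A) :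
    (∀ c ∈ (step C).code, c.writes ⊆ W ∧ c.stores ⊆ A) ∧
      (∀ x ∉ W, (step C).state.reg x = C.state.reg x) ∧
      ∀ a ∉ A, (step C).state.mem a = C.state.mem a := by
  obtain ⟨_ | ⟨c, r⟩, s⟩ := C
  · exact ⟨h, fun _ _ => rfl, fun _ _ => rfl⟩
  · obtain ⟨⟨hW, hA⟩, hr⟩ := List.forall_mem_cons.1 h
    cases c <;> simp only [step] <;> try split_ifs
    all_goals simp_all [Cmd.writes, Cmd.stores, Finset.union_subset_iff, State.setMem]
    all_goals grind

theorem WP.frame {M : ℕ} {c : Cmd} {s : State} {Q : State → Prop} (h : WP M c s Q) :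
    WP M c s fun s' => Q s' ∧ Frame c s s' := by
  have key : ∀ (t : ℕ) (C : Cfg), (∀ d ∈ C.code, d.writes ⊆ c.writes ∧ d.stores ⊆ c.stores) →
      Frame c C.state (step^[t] C).state := by
    intro t
    induction t with
    | zero => exact fun C _ => .refl c C.state
    | succ t ih =>
      intro C hC
      obtain ⟨hcode, hreg, hmem⟩ := step_frame hC
      exact .trans ⟨hreg, hmem⟩ (ih _ hcode) subset_rfl subset_rfl
  obtain ⟨t, ht, s', hQ, hrun⟩ := h
  refine ⟨t, ht, s', ⟨hQ, ?_⟩, hrun⟩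
  obtain ⟨hreg, hmem⟩ := key t ⟨[c], s⟩ (by simp)
  rw [show step^[t] ⟨[c], s⟩ = _ from hrun [] s.coins] at hreg hmem
  exact ⟨hreg, hmem⟩

/-- The counting loop doing `c` for `x = 0, …, reg b - 1`; the register `u` has to contain `1`, and
the register `y` counts the remaining rounds. -/
def forTo (x y b u : ℕ) (c : Cmd) : Cmd :=
  .const x 0 ;; .sub y b x ;; .loop y (c ;; .add x x u ;; .sub y b x)

theorem writes_forTo (x y b u : ℕ) (c : Cmd) :
    (forTo x y b u c).writes = insert x (insert y c.writes) := by
  ext z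
  simp only [forTo, Cmd.writes]
  grind

theorem stores_forTo (x y b u : ℕ) (c : Cmd) : (forTo x y b u c).stores = c.stores := by
  simp [forTo, Cmd.stores]

theorem WP.forTo {M L x y b u : ℕ} {c : Cmd} {s : State} (Inv : ℕ → State → Prop)
    (hb : s.reg b = L) (hu : s.reg u = 1) (hL : L ≤ M) (h0 : Inv 0 s)
    (hbody : ∀ k < L, ∀ s', Frame (forTo x y b u c) s s' → s'.reg x = k → Inv k s' →
      WP M c s' (Inv (k + 1)))
    (hx : ∀ k s v, Inv k s → Inv k (s.setReg x v) := by exact fun _ _ _ h => h)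
    (hy : ∀ k s v, Inv k s → Inv k (s.setReg y v) := by exact fun _ _ _ h => h)
    (hdisj : b ∉ (RAM.forTo x y b u c).writes ∧ u ∉ (RAM.forTo x y b u c).writes ∧
      x ∉ c.writes ∧ x ≠ y := by decide) :
    WP M (RAM.forTo x y b u c) s (Inv L) := by
  obtain ⟨hbw, huw, hxc, hxy⟩ := hdisj
  have hbx : b ≠ x := fun h => hbw (by simp [writes_forTo, h])
  have hxw : x ∈ (RAM.forTo x y b u c).writes := by simp [writes_forTo]
  have hyw : y ∈ (RAM.forTo x y b u c).writes := by simp [writes_forTo]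
  refine .seq (.const (.seq (.sub ?_)))
  refine (WP.loop (fun s' => Frame (RAM.forTo x y b u c) s s' ∧ s'.reg x ≤ L ∧
    s'.reg y = L - s'.reg x ∧ Inv (s'.reg x) s') (fun s' => s'.reg y) ?_ ?_ ?_).mono ?_
  · refine ⟨((Frame.refl _ _).setReg hxw).setReg hyw, by simp [hxy], by simp [hxy, hbx, hb], ?_⟩
    simpa [hxy] using hy _ _ _ (hx _ _ _ h0)
  · simp [hbx, hb, hL]
  · rintro s' ⟨hframe, hle, hrem, hinv⟩ hy0
    refine .seq ((hbody _ (by omega) s' hframe rfl hinv).frame.mono ?_)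
    rintro s'' ⟨hinv', hframe'⟩
    have hframe'' : Frame (RAM.forTo x y b u c) s s'' :=
      hframe.trans hframe' (by grind [writes_forTo]) (by rw [stores_forTo])
    refine .seq (.add (.sub ⟨⟨(hframe''.setReg hxw).setReg hyw, ?_, ?_, ?_⟩, ?_⟩))
    all_goals simp only [State.reg_setReg, hxy, hbx, if_true, if_false, hframe'.reg x hxc,
      hframe''.reg u huw, hframe''.reg b hbw, hu, hb]
    · omega
    · exact hy _ _ _ (hx _ _ _ hinv')
    · omega
  · rintro s' ⟨⟨-, hle, hrem, hinv⟩, hy0⟩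
    rwa [show s'.reg x = L by omega] at hinv

end RAM

/-! ### The program -/

namespace SetPacking

open Finset RAM

namespace Reg

@[simp] abbrev numSets : ℕ := 0
@[simp] abbrev numElems : ℕ := 1
@[simp] abbrev one : ℕ := 2
@[simp] abbrev zero : ℕ := 3
@[simp] abbrev maxSize : ℕ := 4
@[simp] abbrev maxPrice : ℕ := 5
@[simp] abbrev set : ℕ := 6
@[simp] abbrev setLeft : ℕ := 7
@[simp] abbrev elem : ℕ := 8
@[simp] abbrev elemLeft : ℕ := 9
@[simp] abbrev size : ℕ := 10
@[simp] abbrev test : ℕ := 11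
@[simp] abbrev aux : ℕ := 12
@[simp] abbrev owner : ℕ := 13
@[simp] abbrev price : ℕ := 14
@[simp] abbrev best : ℕ := 15
@[simp] abbrev minPrice : ℕ := 16
@[simp] abbrev owned : ℕ := 17
@[simp] abbrev changed : ℕ := 18
@[simp] abbrev round : ℕ := 19
@[simp] abbrev roundLeft : ℕ := 20
@[simp] abbrev target : ℕ := 21
@[simp] abbrev deficit : ℕ := 22

end Reg

namespace Arr

@[simp] abbrev incidence : ℕ := 0
@[simp] abbrev selected : ℕ := 1
@[simp] abbrev part : ℕ := 2
@[simp] abbrev owner : ℕ := 3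
@[simp] abbrev price : ℕ := 4

end Arr

/-- Do `c` for every element of the current set. -/
def forElem (c : Cmd) : Cmd :=
  forTo Reg.elem Reg.elemLeft Reg.numElems Reg.one
    (.load Reg.test Arr.incidence Reg.set Reg.elem ;; .ite Reg.test c .skip)

/-- The truncated differences of `x` and `y` add up to `0` only if `x` and `y` are equal. -/
def distance (x y : ℕ) : Cmd :=
  .sub Reg.test x y ;; .sub Reg.aux y x ;; .add Reg.test Reg.test Reg.aux

/-- Compute the size of the current set. -/
def computeSize : Cmd :=
  .const Reg.size 0 ;; forElem (.add Reg.size Reg.size Reg.one)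

/-- Find out whether the current set holds an element. -/
def computeOwned : Cmd :=
  .const Reg.owned 0 ;; forElem (
    .load Reg.price Arr.price Reg.elem Reg.zero ;;
    .ite Reg.price (
      .load Reg.owner Arr.owner Reg.elem Reg.zero ;;
      distance Reg.owner Reg.set ;;
      .ite Reg.test .skip (.const Reg.owned 1)) .skip)

/-- Find a cheapest element of the current set, provided its price is less than `B`. -/
def computeBest : Cmd :=
  .add Reg.minPrice Reg.maxPrice Reg.zero ;; forElem (
    .load Reg.price Arr.price Reg.elem Reg.zero ;;
    .sub Reg.test Reg.minPrice Reg.price ;;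
    .ite Reg.test (
      .add Reg.minPrice Reg.price Reg.zero ;;
      .add Reg.best Reg.elem Reg.zero) .skip)

/-- Sell the element found by `computeBest` to the current set, for one unit more. -/
def buyBest : Cmd :=
  .add Reg.minPrice Reg.minPrice Reg.one ;;
  .store Arr.owner Reg.best Reg.zero Reg.set ;;
  .store Arr.price Reg.best Reg.zero Reg.minPrice ;;
  .const Reg.changed 1

/-- Let the current set buy a cheapest element, provided its price is less than `B`. -/
def bid : Cmd :=
  computeBest ;; .sub Reg.test Reg.maxPrice Reg.minPrice ;; .ite Reg.test buyBest .skip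

/-- Let the current set bid in the auction, provided it is small and holds nothing. -/
def auctionStep : Cmd :=
  computeSize ;; .sub Reg.test Reg.size Reg.maxSize ;;
  .ite Reg.test .skip (computeOwned ;; .ite Reg.owned .skip bid)

/-- Every set bids once. -/
def auctionRound : Cmd :=
  .const Reg.changed 0 ;; forTo Reg.set Reg.setLeft Reg.numSets Reg.one auctionStep

/-- The sets bid until none of them wants to buy an element. -/
def auction : Cmd :=
  .const Reg.changed 1 ;; .loop Reg.changed auctionRound

/-- Subtract `K` times the number of free elements of the current set from its size. -/
def computeDeficit : Cmd :=
  .add Reg.deficit Reg.size Reg.zero ;; forElem (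
    .load Reg.price Arr.price Reg.elem Reg.zero ;;
    .ite Reg.price .skip (.sub Reg.deficit Reg.deficit Reg.maxSize))

/-- Give free elements to the current set until it holds at least a `1 / K` fraction of itself. -/
def grab : Cmd :=
  .add Reg.deficit Reg.size Reg.zero ;; forElem (
    .ite Reg.deficit (
      .load Reg.price Arr.price Reg.elem Reg.zero ;;
      .ite Reg.price .skip (
        .store Arr.owner Reg.elem Reg.zero Reg.set ;;
        .store Arr.price Reg.elem Reg.zero Reg.one ;;
        .sub Reg.deficit Reg.deficit Reg.maxSize)) .skip)

/-- The greedy choice for the current set, provided its size is the target size. -/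
def greedyStep : Cmd :=
  computeSize ;; distance Reg.size Reg.target ;;
  .ite Reg.test .skip (computeDeficit ;; .ite Reg.deficit .skip grab)

/-- The greedy choice for all sets of the target size. -/
def greedyRound : Cmd :=
  .add Reg.target Reg.round Reg.maxSize ;; .add Reg.target Reg.target Reg.one ;;
  forTo Reg.set Reg.setLeft Reg.numSets Reg.one greedyStep

/-- The greedy choice for the target sizes `K + 1, …, K + N`. -/
def greedy : Cmd :=
  forTo Reg.round Reg.roundLeft Reg.numElems Reg.one greedyRound

/-- Write the allocation to the arrays `1` and `2`. -/
def output : Cmd :=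
  forTo Reg.elem Reg.elemLeft Reg.numElems Reg.one (
    .load Reg.price Arr.price Reg.elem Reg.zero ;;
    .ite Reg.price (
      .load Reg.owner Arr.owner Reg.elem Reg.zero ;;
      .store Arr.selected Reg.owner Reg.zero Reg.one ;;
      .store Arr.part Reg.owner Reg.elem Reg.one) .skip)

/-- The algorithm: an auction for the sets of size at most `K`, with prices at most `B`, and then a
greedy choice among the larger sets, in the order of their sizes. -/
def packing (K B : ℕ) : Cmd :=
  .const Reg.one 1 ;; .const Reg.maxSize K ;; .const Reg.maxPrice B ;; auction ;; greedy ;; output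

/-- The allocation stored in the arrays of the machine. -/
def alloc (s : State) : Alloc ℕ ℕ where
  owner j := s.mem Arr.owner j 0
  price j := s.mem Arr.price j 0

/-- The data of the machine describe the family `E` of `n` subsets of `{0, …, N - 1}`, the register
constants are set up, and `M` bounds the number of rounds of all loops. -/
structure Ctx (E : ℕ → Finset ℕ) (M n N K B : ℕ) (s : State) : Prop where
  numSets : s.reg Reg.numSets = n
  numElems : s.reg Reg.numElems = N
  one : s.reg Reg.one = 1
  zero : s.reg Reg.zero = 0
  maxSize : s.reg Reg.maxSize = K
  maxPrice : s.reg Reg.maxPrice = B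
  incidence : ∀ i j, s.mem Arr.incidence i j ≠ 0 ↔ j ∈ E i
  subset : ∀ i, E i ⊆ range N
  eq_empty : ∀ i, n ≤ i → E i = ∅
  numSets_le : n ≤ M
  numElems_le : N ≤ M
  prices_lt : N * B < M

/-! ### Correctness of the program -/

variable {E : ℕ → Finset ℕ} {M n N K B i : ℕ} {s s' : State}

@[simp]
theorem alloc_setReg (x v : ℕ) : alloc (s.setReg x v) = alloc s := rfl

theorem alloc_eq_of_frame {c : Cmd} (h : Frame c s s')
    (hc : Arr.owner ∉ c.stores ∧ Arr.price ∉ c.stores := by decide) : alloc s' = alloc s := by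
  simp only [alloc, h.mem _ hc.1, h.mem _ hc.2]

theorem Ctx.frame {c : Cmd} (hctx : Ctx E M n N K B s) (h : Frame c s s')
    (hw : ∀ x ∈ c.writes, Reg.maxPrice < x := by decide)
    (hs : Arr.incidence ∉ c.stores := by decide) : Ctx E M n N K B s' := by
  have hreg : ∀ x ≤ Reg.maxPrice, s'.reg x = s.reg x := fun x hx =>
    h.reg x fun hxc => (hw x hxc).not_ge hx
  exact { hctx with
    numSets := (hreg _ (by decide)).trans hctx.numSets
    numElems := (hreg _ (by decide)).trans hctx.numElems
    one := (hreg _ (by decide)).trans hctx.one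
    zero := (hreg _ (by decide)).trans hctx.zero
    maxSize := (hreg _ (by decide)).trans hctx.maxSize
    maxPrice := (hreg _ (by decide)).trans hctx.maxPrice
    incidence := (h.mem _ hs).symm ▸ hctx.incidence }

theorem Ctx.setReg {x v : ℕ} (hctx : Ctx E M n N K B s) (hx : Reg.maxPrice < x := by decide) :
    Ctx E M n N K B (s.setReg x v) :=
  hctx.frame (c := .const x 0) (Frame.refl _ _ |>.setReg (mem_singleton_self x))
    (fun _ hy => mem_singleton.1 hy ▸ hx) (notMem_empty _)

theorem wp_forElem {c : Cmd} (hctx : Ctx E M n N K B s) (hi : s.reg Reg.set = i)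
    (Inv : Finset ℕ → State → Prop) (h0 : Inv ∅ s)
    (hbody : ∀ G ⊆ E i, ∀ j ∈ E i, j ∉ G → ∀ s', Frame (forElem c) s s' →
      Ctx E M n N K B s' → s'.reg Reg.set = i → s'.reg Reg.elem = j → Inv G s' →
        WP M c s' (Inv (insert j G)))
    (hInv : ∀ G s v, Inv G s → Inv G (s.setReg Reg.elem v) ∧ Inv G (s.setReg Reg.elemLeft v) ∧
      Inv G (s.setReg Reg.test v) := by exact fun _ _ _ h => ⟨h, h, h⟩)
    (hdisj : (∀ x ∈ (forElem c).writes, Reg.maxPrice < x) ∧ Reg.set ∉ (forElem c).writes ∧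
      Reg.elem ∉ c.writes ∧ Arr.incidence ∉ c.stores := by decide) :
    WP M (forElem c) s (Inv (E i)) := by
  obtain ⟨hconst, hset, helem, hinc⟩ := hdisj
  have hwrites : (forElem c).writes = insert Reg.elem (insert Reg.elemLeft
      (insert Reg.test c.writes)) := by
    simp [forElem, writes_forTo, Cmd.writes]
  have hstores : (forElem c).stores = c.stores := by simp [forElem, stores_forTo, Cmd.stores]
  have hfilter : {j ∈ E i | j < N} = E i :=
    filter_true_of_mem fun j hj => mem_range.1 (hctx.subset i hj)
  rw [← hfilter]
  refine WP.forTo (fun k => Inv {j ∈ E i | j < k}) hctx.numElems hctx.one hctx.numElems_le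
    (by simpa using h0) ?_ (fun k s v h => (hInv _ s v h).1) (fun k s v h => (hInv _ s v h).2.1)
    ⟨fun h => absurd (hconst _ h) (by decide), fun h => absurd (hconst _ h) (by decide),
      by simpa [Cmd.writes] using helem, by decide⟩
  intro k hk s' hframe helem' hinv
  have hsucc : {j ∈ E i | j < k + 1} = if k ∈ E i then insert k {j ∈ E i | j < k}
      else {j ∈ E i | j < k} := by
    ext j
    split_ifs <;> grind
  have hmem : s'.mem Arr.incidence (s'.reg Reg.set) (s'.reg Reg.elem) ≠ 0 ↔ k ∈ E i := by
    rw [hframe.mem _ (by rwa [← forElem, hstores]), hframe.reg _ hset, hi, helem', hctx.incidence]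
  have htest : Reg.test ∈ (forElem c).writes := by simp [hwrites]
  have hset' : s'.reg Reg.set = i := (hframe.reg _ hset).trans hi
  have hctx' : Ctx E M n N K B s' := hctx.frame hframe hconst (by rwa [← forElem, hstores])
  refine .seq (.load (.ite (fun ht => ?_) fun ht => .skip ?_))
  · have hk' := hmem.1 (by simpa using ht)
    rw [hsucc, if_pos hk']
    exact hbody _ (filter_subset _ _) k hk' (by simp) _ (hframe.setReg htest) hctx'.setReg
      (by simpa using hset') (by simpa using helem') (hInv _ _ _ hinv).2.2
  · have hk' := hmem.not.1 (by simpa using ht)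
    rw [hsucc, if_neg hk']
    exact (hInv _ _ _ hinv).2.2

theorem wp_distance {x y : ℕ} {Q : State → Prop}
    (h : ∀ u v w, (w = 0 ↔ s.reg x = s.reg y) →
      Q (((s.setReg Reg.test u).setReg Reg.aux v).setReg Reg.test w))
    (hxy : x ≠ Reg.test ∧ y ≠ Reg.test := by decide) : WP M (distance x y) s Q := by
  refine .seq (.sub (.seq (.sub (.add (h _ _ _ ?_)))))
  simp [hxy.1, hxy.2]
  omega

theorem wp_computeSize (hctx : Ctx E M n N K B s) (hi : s.reg Reg.set = i) :
    WP M computeSize s fun s' => s'.reg Reg.size = #(E i) := by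
  refine .seq (.const (wp_forElem hctx.setReg (by simpa using hi)
    (fun G s' => s'.reg Reg.size = #G) (by simp) ?_))
  intro G _ j _ hjG s' _ hctx' _ _ hsize
  exact .add (by simp [hsize, hctx'.one, card_insert_of_notMem hjG])

theorem mem_price_eq {j : ℕ} (hctx : Ctx E M n N K B s) (hj : s.reg Reg.elem = j) :
    s.mem Arr.price (s.reg Reg.elem) (s.reg Reg.zero) = (alloc s).price j := by
  rw [hj, hctx.zero, alloc]

theorem mem_owner_eq {j : ℕ} (hctx : Ctx E M n N K B s) (hj : s.reg Reg.elem = j) :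
    s.mem Arr.owner (s.reg Reg.elem) (s.reg Reg.zero) = (alloc s).owner j := by
  rw [hj, hctx.zero, alloc]

theorem wp_computeOwned (hctx : Ctx E M n N K B s) (hi : s.reg Reg.set = i) :
    WP M computeOwned s fun s' => s'.reg Reg.owned = 0 ↔ (alloc s).part E i = ∅ := by
  refine .seq (.const ((wp_forElem hctx.setReg (by simpa using hi) (fun G s' =>
    s'.reg Reg.owned = 0 ↔ ∀ j ∈ G, ¬ ((alloc s).price j ≠ 0 ∧ (alloc s).owner j = i))
    (by simp) ?_).mono fun s' h => ?_))
  · intro G _ j _ _ s' hframe hctx' _ helem howned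
    have halloc : alloc s' = alloc s := (alloc_eq_of_frame hframe).trans rfl
    refine .seq (.load ?_)
    rw [mem_price_eq hctx' helem, halloc]
    refine .ite (fun hp => .seq (.load ?_)) fun hp => .skip ?_
    · rw [mem_owner_eq hctx'.setReg (by simpa using helem), alloc_setReg, halloc]
      refine .seq (wp_distance fun u v w hw => .ite (fun ht => .skip ?_) fun ht => .const ?_)
      · simp_all
      · simp_all
    · simp_all
  · rw [h, Alloc.part, filter_eq_empty_iff]

theorem wp_computeBest (hctx : Ctx E M n N K B s) (hi : s.reg Reg.set = i) :
    WP M computeBest s fun s' => s'.reg Reg.minPrice ≤ B ∧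
      (∀ j ∈ E i, s'.reg Reg.minPrice ≤ (alloc s).price j) ∧
      (s'.reg Reg.minPrice < B → s'.reg Reg.best ∈ E i ∧
        (alloc s).price (s'.reg Reg.best) = s'.reg Reg.minPrice) := by
  refine .seq (.add (wp_forElem hctx.setReg (by simpa using hi) (fun G s' =>
    s'.reg Reg.minPrice ≤ B ∧ (∀ j ∈ G, s'.reg Reg.minPrice ≤ (alloc s).price j) ∧
      (s'.reg Reg.minPrice < B → s'.reg Reg.best ∈ G ∧
        (alloc s).price (s'.reg Reg.best) = s'.reg Reg.minPrice)) ?_ ?_))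
  · simp [hctx.maxPrice, hctx.zero]
  · intro G hG j hj hjG s' hframe hctx' hset helem hinv
    have halloc : alloc s' = alloc s := (alloc_eq_of_frame hframe).trans rfl
    refine .seq (.load ?_)
    rw [mem_price_eq hctx' helem, halloc]
    refine .seq (.sub (.ite (fun ht => .seq (.add (.add ?_))) fun ht => .skip ?_))
    · simp_all [hctx'.zero]
      grind
    · simp_all
      grind

theorem alloc_setMem_owner_price (i j p : ℕ) :
    alloc ((s.setMem Arr.owner j 0 i).setMem Arr.price j 0 p) = (alloc s).give i {j} p := by
  simp only [alloc, Alloc.give, State.mem_setMem, mem_singleton]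
  simp

theorem wp_buyBest (hctx : Ctx E M n N K B s) (hi : s.reg Reg.set = i) {j : ℕ}
    (hj : s.reg Reg.best = j) (hp : s.reg Reg.minPrice = (alloc s).price j) :
    WP M buyBest s fun s' => alloc s' = (alloc s).give i {j} ((alloc s).price j + 1) ∧
      s'.reg Reg.changed = 1 := by
  refine .seq (.add (.seq (.store (.seq (.store (.const ⟨?_, by simp⟩))))))
  simpa [hctx.one, hctx.zero, hi, hj, hp] using alloc_setMem_owner_price
    (s := s.setReg Reg.minPrice ((alloc s).price j + 1)) i j ((alloc s).price j + 1)

/-- The effect of a bid of the set number `i` in the auction: either the set wants no element and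
nothing changes, or it buys an element that it wants. -/
def Bid (E : ℕ → Finset ℕ) (K B i : ℕ) (s s' : State) : Prop :=
  (alloc s' = alloc s ∧ s'.reg Reg.changed = s.reg Reg.changed ∧
    ∀ j, ¬ (alloc s).Wants E K B i j) ∨
  ∃ j, (alloc s).Wants E K B i j ∧ alloc s' = (alloc s).give i {j} ((alloc s).price j + 1) ∧
    s'.reg Reg.changed = 1

theorem wp_bid (hctx : Ctx E M n N K B s) (hi : s.reg Reg.set = i) (hsmall : #(E i) ≤ K)
    (hpart : (alloc s).part E i = ∅) : WP M bid s (Bid E K B i s) := by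
  refine .seq ((wp_computeBest hctx hi).frame.mono ?_)
  rintro s' ⟨⟨-, hmin, hbest⟩, hframe⟩
  have hctx' := hctx.frame hframe
  have halloc : alloc s' = alloc s := alloc_eq_of_frame hframe
  have hi' : s'.reg Reg.set = i := (hframe.reg _ (by decide)).trans hi
  refine .seq (.sub (.ite (fun ht => ?_) fun ht => .skip (.inl ⟨halloc, ?_, fun j hw => ?_⟩)))
  · have hlt : s'.reg Reg.minPrice < B := by simpa [hctx'.maxPrice, Nat.sub_ne_zero_iff_lt] using ht
    obtain ⟨hmem, hprice⟩ := hbest hlt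
    refine (wp_buyBest hctx'.setReg (i := i) (by simpa using hi') rfl
      (by simp [hprice, halloc])).mono fun s'' h => .inr ⟨s'.reg Reg.best, ?_, ?_⟩
    · exact ⟨hsmall, hpart, hmem, hprice ▸ hlt, fun j' hj' => hprice ▸ hmin j' hj'⟩
    · simpa [halloc] using h
  · simpa using hframe.reg Reg.changed (by decide)
  · have hge : B ≤ s'.reg Reg.minPrice := by
      simpa [hctx'.maxPrice, Nat.sub_eq_zero_iff_le] using ht
    exact (hge.trans (hmin j hw.mem)).not_gt hw.lt

theorem Bid.of_frame {c : Cmd} {s'' : State} (h : Bid E K B i s' s'') (hframe : Frame c s s')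
    (hchanged : Reg.changed ∉ c.writes := by decide)
    (hc : Arr.owner ∉ c.stores ∧ Arr.price ∉ c.stores := by decide) : Bid E K B i s s'' := by
  rwa [Bid, alloc_eq_of_frame hframe hc, hframe.reg _ hchanged] at h

theorem wp_auctionStep (hctx : Ctx E M n N K B s) (hi : s.reg Reg.set = i) :
    WP M auctionStep s (Bid E K B i s) := by
  refine .seq ((wp_computeSize hctx hi).frame.mono ?_)
  rintro s₁ ⟨hsize, hframe₁⟩
  refine WP.mono ?_ fun s' (h : Bid E K B i s₁ s') => h.of_frame hframe₁
  have hctx₁ := hctx.frame hframe₁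
  have hi₁ : s₁.reg Reg.set = i := (hframe₁.reg _ (by decide)).trans hi
  refine .seq (.sub ?_)
  simp only [hsize, hctx₁.maxSize]
  refine .ite (fun ht => .skip (.inl ⟨rfl, rfl, fun j hw => ?_⟩)) fun ht => ?_
  · simp [Nat.sub_eq_zero_iff_le.2 hw.small] at ht
  have hsmall : #(E i) ≤ K := by simpa [Nat.sub_eq_zero_iff_le] using ht
  refine .seq ((wp_computeOwned hctx₁.setReg (i := i) (by simpa using hi₁)).frame.mono ?_)
  rintro s₂ ⟨howned, hframe₂⟩
  refine WP.mono ?_ fun s' (h : Bid E K B i s₂ s') => (h.of_frame hframe₂ :)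
  rw [← alloc_eq_of_frame hframe₂] at howned
  refine .ite (fun ho => .skip (.inl ⟨rfl, rfl, fun j hw => ho (howned.2 hw.part_eq)⟩)) fun ho => ?_
  exact wp_bid (hctx₁.setReg.frame hframe₂) ((hframe₂.reg _ (by decide)).trans (by simpa using hi₁))
    hsmall (howned.1 ho)

/-- The effect of a round of bids on an allocation: either no set wants an element and nothing
changes, or the sum of the prices increases. -/
def BidRound (E : ℕ → Finset ℕ) (N K B k : ℕ) (s s' : State) : Prop :=
  (alloc s' = alloc s ∧ s'.reg Reg.changed = 0 ∧ ∀ i < k, ∀ j, ¬ (alloc s).Wants E K B i j) ∨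
  (∑ j ∈ range N, (alloc s).price j < ∑ j ∈ range N, (alloc s').price j ∧ s'.reg Reg.changed = 1)

theorem BidRound.bid {s'' : State} {k : ℕ} (hE : ∀ i, E i ⊆ range N)
    (h : BidRound E N K B k s s') (hbid : Bid E K B k s' s'') :
    BidRound E N K B (k + 1) s s'' := by
  obtain ⟨halloc, hchanged, hnone⟩ | ⟨j, hw, halloc, hchanged⟩ := hbid
  · rw [BidRound, halloc, hchanged]
    refine h.imp_left fun ⟨halloc', hchanged', hk⟩ => ⟨halloc', hchanged', fun i hi => ?_⟩
    obtain hi | rfl := Nat.lt_succ_iff_lt_or_eq.1 hi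
    exacts [hk i hi, halloc' ▸ hnone]
  · refine .inr ⟨?_, hchanged⟩
    rw [halloc, Alloc.sum_price_give_singleton (hE k hw.mem), Nat.lt_succ_iff]
    obtain ⟨halloc', -⟩ | ⟨hlt, -⟩ := h
    exacts [halloc' ▸ le_rfl, hlt.le]

theorem wp_auctionRound (hctx : Ctx E M n N K B s) (hinv : (alloc s).AuctionInv E K B) :
    WP M auctionRound s fun s' => (alloc s').AuctionInv E K B ∧ BidRound E N K B n s s' := by
  refine .seq (.const (WP.forTo (fun k s' => (alloc s').AuctionInv E K B ∧ BidRound E N K B k s s')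
    hctx.setReg.numSets hctx.setReg.one hctx.numSets_le
    ⟨hinv, .inl ⟨rfl, by simp, by simp⟩⟩ ?_))
  rintro k - s' hframe hset ⟨hinv', hround⟩
  refine (wp_auctionStep (hctx.setReg.frame hframe) hset).mono fun s'' hbid => ⟨?_, ?_⟩
  · obtain ⟨halloc, -⟩ | ⟨j, hw, halloc, -⟩ := hbid
    exacts [halloc ▸ hinv', halloc ▸ hinv'.buy hw]
  · exact hround.bid hctx.subset hbid

theorem wp_auction (hctx : Ctx E M n N K B s) (hfree : ∀ j, (alloc s).price j = 0) :
    WP M auction s fun s' => (alloc s').AuctionInv E K B ∧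
      ∀ i j, ¬ (alloc s').Wants E K B i j := by
  have hinit : (alloc s).AuctionInv E K B := by
    constructor <;> simp [hfree, Alloc.Valid]
  refine .seq (.const ((WP.loop (fun s' => Ctx E M n N K B s' ∧ (alloc s').AuctionInv E K B ∧
      s'.reg Reg.changed ≤ 1 ∧ (s'.reg Reg.changed = 0 → ∀ i j, ¬ (alloc s').Wants E K B i j))
    (fun s' => N * B - ∑ j ∈ range N, (alloc s').price j + s'.reg Reg.changed)
    ⟨hctx.setReg, hinit, by simp, by simp⟩ ?_ ?_).mono fun s' ⟨h, h0⟩ => ⟨h.2.1, h.2.2.2 h0⟩))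
  · simpa [hfree] using hctx.prices_lt
  rintro s' ⟨hctx', hinv, hle, -⟩ hne
  have hone : s'.reg Reg.changed = 1 := by omega
  refine (wp_auctionRound hctx' hinv).frame.mono fun s'' ⟨⟨hinv', hround⟩, hframe⟩ => ?_
  have hsum : ∑ j ∈ range N, (alloc s'').price j ≤ N * B := by
    simpa using sum_le_card_nsmul (range N) _ B fun j _ => hinv'.le j
  obtain ⟨halloc, hzero, hnone⟩ | ⟨hlt, hone'⟩ := hround
  · refine ⟨⟨hctx'.frame hframe, hinv', by omega, fun _ i j hw => ?_⟩, by rw [halloc]; omega⟩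
    by_cases hi : i < n
    · exact hnone i hi j (halloc ▸ hw)
    · simpa [hctx.eq_empty i (not_lt.1 hi)] using hw.mem
  · exact ⟨⟨hctx'.frame hframe, hinv', hone'.le, fun h => by omega⟩, by omega⟩

theorem wp_computeDeficit (hctx : Ctx E M n N K B s) (hi : s.reg Reg.set = i)
    (hsize : s.reg Reg.size = #(E i)) :
    WP M computeDeficit s fun s' =>
      s'.reg Reg.deficit = #(E i) - K * #{j ∈ E i | (alloc s).price j = 0} := by
  refine .seq (.add (wp_forElem hctx.setReg (by simpa using hi)
    (fun G s' => s'.reg Reg.deficit = #(E i) - K * #{j ∈ G | (alloc s).price j = 0})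
    (by simp [hsize, hctx.zero]) ?_))
  intro G _ j _ hjG s' hframe hctx' _ helem hdeficit
  have halloc : alloc s' = alloc s := (alloc_eq_of_frame hframe).trans rfl
  refine .seq (.load ?_)
  rw [mem_price_eq hctx' helem, halloc]
  refine .ite (fun hp => .skip ?_) fun hp => .sub ?_
  · have hp' : (alloc s).price j ≠ 0 := by simpa using hp
    simpa [filter_insert, hp'] using hdeficit
  · have hp' : (alloc s).price j = 0 := by simpa using hp
    simp [filter_insert, hp', hjG, hdeficit, hctx'.maxSize, Nat.mul_succ, Nat.sub_sub]

/-- The state of `grab` when it has passed through the elements of `G`; the set number `i` has been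
given the elements of `A`. -/
structure Grabbed (E : ℕ → Finset ℕ) (K i : ℕ) (a : Alloc ℕ ℕ) (G A : Finset ℕ) (s : State) :
    Prop where
  subset : A ⊆ {j ∈ G | a.price j = 0}
  alloc_eq : alloc s = a.give i A 1
  deficit_eq : s.reg Reg.deficit = #(E i) - K * #A
  lt : K * #A < #(E i) + K
  eq_of_deficit : s.reg Reg.deficit ≠ 0 → A = {j ∈ G | a.price j = 0}

theorem Grabbed.setReg {a : Alloc ℕ ℕ} {G A : Finset ℕ} {x v : ℕ} (h : Grabbed E K i a G A s)
    (hx : Reg.deficit ≠ x := by decide) : Grabbed E K i a G A (s.setReg x v) := by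
  have hd : (s.setReg x v).reg Reg.deficit = s.reg Reg.deficit := by
    rw [State.reg_setReg, if_neg hx]
  exact ⟨h.subset, h.alloc_eq, hd ▸ h.deficit_eq, h.lt, hd ▸ h.eq_of_deficit⟩

theorem Grabbed.pass {a : Alloc ℕ ℕ} {G A : Finset ℕ} {j : ℕ} (h : Grabbed E K i a G A s)
    (hj : s.reg Reg.deficit ≠ 0 → a.price j ≠ 0) : Grabbed E K i a (insert j G) A s where
  subset := h.subset.trans (filter_subset_filter _ (subset_insert j G))
  alloc_eq := h.alloc_eq
  deficit_eq := h.deficit_eq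
  lt := h.lt
  eq_of_deficit hd := by rw [filter_insert, if_neg (hj hd), ← h.eq_of_deficit hd]

theorem Grabbed.take {a : Alloc ℕ ℕ} {G A : Finset ℕ} {j : ℕ} (h : Grabbed E K i a G A s)
    (hjG : j ∉ G) (hd : s.reg Reg.deficit ≠ 0) (hj : a.price j = 0)
    (halloc : alloc s' = (alloc s).give i {j} 1)
    (hdeficit : s'.reg Reg.deficit = s.reg Reg.deficit - K) :
    Grabbed E K i a (insert j G) (insert j A) s' := by
  have hjA : j ∉ A := fun hA => hjG (mem_filter.1 (h.subset hA)).1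
  have hlt : K * #A < #(E i) := by
    have := h.deficit_eq
    omega
  have heq : insert j A = {l ∈ insert j G | a.price l = 0} := by
    rw [filter_insert, if_pos hj, ← h.eq_of_deficit hd]
  refine ⟨heq.le, ?_, ?_, ?_, fun _ => heq⟩
  · rw [halloc, h.alloc_eq]
    ext l <;> simp only [Alloc.give] <;> grind
  · rw [hdeficit, h.deficit_eq, card_insert_of_notMem hjA, Nat.mul_succ, Nat.sub_sub]
  · rw [card_insert_of_notMem hjA, Nat.mul_succ]
    omega

theorem wp_grab (hctx : Ctx E M n N K B s) (hi : s.reg Reg.set = i)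
    (hsize : s.reg Reg.size = #(E i)) (hlarge : K < #(E i))
    (hmany : #(E i) ≤ K * #{j ∈ E i | (alloc s).price j = 0}) :
    WP M grab s fun s' => (alloc s).GreedyStep E K i (alloc s') := by
  refine .seq (.add ((wp_forElem hctx.setReg (by simpa using hi)
    (fun G s' => ∃ A, Grabbed E K i (alloc s) G A s') ⟨∅, ?_⟩ ?_
    fun G s' v ⟨A, hA⟩ => ⟨⟨A, hA.setReg⟩, ⟨A, hA.setReg⟩, ⟨A, hA.setReg⟩⟩).mono ?_))
  · exact ⟨subset_rfl, by simp [Alloc.give], by simp [hsize, hctx.zero],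
      by rw [card_empty]; omega, fun _ => rfl⟩
  · rintro G _ j _ hjG s' _ hctx' hset helem ⟨A, hA⟩
    have hprice : (alloc s').price j = (alloc s).price j := by
      have hjA : j ∉ A := fun hjA => hjG (mem_filter.1 (hA.subset hjA)).1
      simp [hA.alloc_eq, Alloc.give, hjA]
    refine .ite (fun hd => .seq (.load ?_)) fun hd => .skip ⟨A, hA.pass fun h => absurd hd h⟩
    rw [mem_price_eq hctx' helem, hprice]
    refine .ite (fun hp => .skip ⟨A, ?_⟩) fun hp =>
      .seq (.store (.seq (.store (.sub ⟨insert j A, ?_⟩))))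
    · exact hA.setReg.pass fun _ => by simpa using hp
    · refine hA.take hjG hd (by simpa using hp) ?_ ?_
      · simpa [hset, helem, hctx'.zero, hctx'.one] using
          alloc_setMem_owner_price (s := s'.setReg Reg.price ((alloc s).price j)) i j 1
      · simp [hctx'.maxSize]
  · rintro s' ⟨A, hA⟩
    have hle : #(E i) ≤ K * #A := by
      by_contra! hlt
      have hd := hA.deficit_eq
      rw [← hA.eq_of_deficit (by omega)] at hmany
      omega
    rw [hA.alloc_eq]
    exact .accept A hA.subset hle hA.lt

theorem wp_greedyStep (hctx : Ctx E M n N K B s) (hi : s.reg Reg.set = i)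
    (hlarge : K < s.reg Reg.target) :
    WP M greedyStep s fun s' =>
      if #(E i) = s.reg Reg.target then (alloc s).GreedyStep E K i (alloc s')
      else alloc s' = alloc s := by
  refine .seq ((wp_computeSize hctx hi).frame.mono ?_)
  rintro s₁ ⟨hsize, hframe₁⟩
  have hctx₁ := hctx.frame hframe₁
  have hi₁ : s₁.reg Reg.set = i := (hframe₁.reg _ (by decide)).trans hi
  rw [← alloc_eq_of_frame hframe₁]
  rw [← hframe₁.reg Reg.target (by decide)] at hlarge ⊢
  refine .seq (wp_distance fun u v w hw => .ite (fun ht => .skip ?_) fun ht => ?_)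
  · rw [hsize] at hw
    rw [if_neg fun h => ht (by simpa using hw.2 h)]
    rfl
  rw [hsize] at hw
  have hq : #(E i) = s₁.reg Reg.target := hw.1 (by simpa using ht)
  simp only [if_pos hq]
  refine .seq ((wp_computeDeficit (i := i) hctx₁.setReg.setReg.setReg (by simpa using hi₁)
    (by simpa using hsize)).frame.mono ?_)
  rintro s₂ ⟨hdeficit, hframe₂⟩
  rw [← hq] at hlarge
  have halloc : alloc s₂ = alloc s₁ := (alloc_eq_of_frame hframe₂).trans rfl
  simp only [alloc_setReg, ← halloc] at hdeficit ⊢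
  refine .ite (fun hd => .skip (.reject (by omega))) fun hd =>
    wp_grab (hctx₁.setReg.setReg.setReg.frame hframe₂) ?_ ?_ hlarge (by omega)
  · exact (hframe₂.reg _ (by decide)).trans (by simpa using hi₁)
  · exact (hframe₂.reg _ (by decide)).trans (by simpa using hsize)

/-- The sets treated by the greedy choice before it comes to the set number `i` in the round for the
sets of size `q`. -/
def treated (E : ℕ → Finset ℕ) (q i : ℕ) : Set ℕ := {t | #(E t) < q ∨ #(E t) = q ∧ t < i}

theorem treated_succ_of_card_eq {q : ℕ} (hi : #(E i) = q) :
    treated E q (i + 1) = insert i (treated E q i) := by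
  ext t
  simp only [treated, Set.mem_ofPred_eq, Set.mem_insert_iff]
  grind

theorem treated_succ_of_card_ne {q : ℕ} (hi : #(E i) ≠ q) :
    treated E q (i + 1) = treated E q i := by
  ext t
  simp only [treated, Set.mem_ofPred_eq]
  grind

theorem treated_zero (E : ℕ → Finset ℕ) (q : ℕ) : treated E q 0 = {t | #(E t) < q} := by
  simp [treated]

theorem treated_of_eq_empty {q : ℕ} (hq : 0 < q) (hE : ∀ i, n ≤ i → E i = ∅) :
    treated E q n = treated E (q + 1) 0 := by
  ext t
  rw [treated_zero]
  simp only [treated, Set.mem_ofPred_eq]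
  refine ⟨by omega, fun ht => ?_⟩
  by_cases htn : t < n
  · omega
  · simp [hE t (not_lt.1 htn), hq]

theorem wp_greedyRound {T : Finset ℕ} {r : ℕ} (hctx : Ctx E M n N K B s) (hr : s.reg Reg.round = r)
    (hinv : (alloc s).GreedyInv E K T (treated E (r + K + 1) 0)) :
    WP M greedyRound s fun s' => (alloc s').GreedyInv E K T (treated E (r + K + 1 + 1) 0) := by
  refine .seq (.add (.seq (.add ?_)))
  set s₁ := (s.setReg _ _).setReg _ _ with hs₁
  have hctx₁ : Ctx E M n N K B s₁ := hctx.setReg.setReg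
  have htarget : s₁.reg Reg.target = r + K + 1 := by simp [hs₁, hr, hctx.maxSize, hctx.one]
  rw [← treated_of_eq_empty (by omega) hctx.eq_empty]
  refine WP.forTo (fun k s' => (alloc s').GreedyInv E K T (treated E (r + K + 1) k))
    hctx₁.numSets hctx₁.one hctx₁.numSets_le hinv ?_
  intro k _ s' hframe hset hinv'
  have htarget' : s'.reg Reg.target = r + K + 1 := (hframe.reg _ (by decide)).trans htarget
  refine (wp_greedyStep (hctx₁.frame hframe) hset (by omega)).mono fun s'' h => ?_
  rw [htarget'] at h
  split_ifs at h with hk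
  · rw [treated_succ_of_card_eq hk]
    refine hinv'.step (by simp [treated, hk]) (fun t ht => ?_) (by omega) h
    rcases ht with ht | ht <;> omega
  · rwa [treated_succ_of_card_ne hk, h]

theorem wp_greedy {T : Finset ℕ} (hctx : Ctx E M n N K B s)
    (hinv : (alloc s).GreedyInv E K T {i | #(E i) < K + 1}) :
    WP M greedy s fun s' => (alloc s').GreedyInv E K T Set.univ := by
  have huniv : treated E (N + K + 1) 0 = Set.univ := by
    refine Set.eq_univ_of_forall fun t => ?_
    have hcard : #(E t) ≤ N := by simpa using card_le_card (hctx.subset t)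
    exact .inl (by omega)
  rw [← huniv]
  refine WP.forTo (fun r s' => (alloc s').GreedyInv E K T (treated E (r + K + 1) 0))
    hctx.numElems hctx.one hctx.numElems_le (by simpa [treated_zero] using hinv) ?_
  intro r _ s' hframe hround hinv'
  simpa only [add_right_comm _ 1] using wp_greedyRound (hctx.frame hframe) hround hinv'

/-- The output arrays of the data `s` describe the allocation `a` of the elements of `G`. -/
structure Written (a : Alloc ℕ ℕ) (G : Finset ℕ) (s : State) : Prop where
  selected : ∀ i, s.mem Arr.selected i 0 ≠ 0 ↔ i ∈ a.winners G
  part : ∀ i j, s.mem Arr.part i j ≠ 0 ↔ j ∈ G ∧ a.price j ≠ 0 ∧ a.owner j = i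

theorem wp_output (hctx : Ctx E M n N K B s)
    (hmem : s.mem Arr.selected = 0 ∧ s.mem Arr.part = 0) :
    WP M output s (Written (alloc s) (range N)) := by
  refine WP.forTo (fun k s' => Written (alloc s) (range k) s') hctx.numElems hctx.one
    hctx.numElems_le ⟨by simp [hmem, Alloc.winners], by simp [hmem]⟩ ?_
    (fun _ _ _ h => ⟨h.1, h.2⟩) (fun _ _ _ h => ⟨h.1, h.2⟩)
  intro k hk s' hframe helem h
  have hctx' := hctx.frame hframe
  have halloc : alloc s' = alloc s := alloc_eq_of_frame hframe
  refine .seq (.load ?_)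
  rw [mem_price_eq hctx' helem, halloc, range_add_one]
  refine .ite (fun hp => .seq (.load ?_)) fun hp => .skip ?_
  · rw [mem_owner_eq hctx'.setReg (by simpa using helem), alloc_setReg, halloc]
    have hp' : (alloc s).price k ≠ 0 := by simpa using hp
    refine .seq (.store (.store ⟨fun i => ?_, fun i j => ?_⟩))
    · by_cases hi : i = (alloc s).owner k
      · simp [Alloc.winners, filter_insert, hp', hctx'.one, hctx'.zero, hi]
      · simpa [Alloc.winners, filter_insert, hp', hctx'.zero, hi] using h.selected i
    · obtain rfl | hj := eq_or_ne j k
      · have hnone : s'.mem Arr.part i j = 0 := by simpa using h.part i j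
        simp [helem, hctx'.one, hp', hnone, eq_comm]
      · simpa [helem, hj] using h.part i j
  · have hp' : (alloc s).price k = 0 := by simpa using hp
    refine ⟨fun i => ?_, fun i j => ?_⟩
    · simpa [Alloc.winners, filter_insert, hp'] using h.selected i
    · obtain rfl | hj := eq_or_ne j k
      · simpa [hp'] using h.part i j
      · simpa [hj] using h.part i j

theorem wp_packing
    (hctx : Ctx E M n N (2 * (B + 1)) B
      (((s.setReg Reg.one 1).setReg Reg.maxSize (2 * (B + 1))).setReg Reg.maxPrice B))
    (hmem : ∀ a ≠ Arr.incidence, s.mem a = 0) :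
    WP M (packing (2 * (B + 1)) B) s fun s' =>
      ∃ a : Alloc ℕ ℕ, a.NearOptimal E (2 * (B + 1)) B (range N) ∧ Written a (range N) s' := by
  refine .seq (.const (.seq (.const (.seq (.const (.seq ?_))))))
  refine (wp_auction hctx fun j => by simp [alloc, hmem]).frame.mono ?_
  rintro s₁ ⟨⟨hauction, hcontent⟩, hframe₁⟩
  refine .seq ((wp_greedy (hctx.frame hframe₁) (hauction.greedyInv hctx.subset)).frame.mono ?_)
  rintro s₂ ⟨hgreedy, hframe₂⟩
  refine (wp_output ((hctx.frame hframe₁).frame hframe₂) ⟨?_, ?_⟩).mono fun s' h =>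
    ⟨_, hgreedy.nearOptimal hauction hcontent hctx.subset, h⟩
  · rw [hframe₂.mem _ (by decide), hframe₁.mem _ (by decide)]
    exact hmem _ (by decide)
  · rw [hframe₂.mem _ (by decide), hframe₁.mem _ (by decide)]
    exact hmem _ (by decide)

/-- The family `S` as a sequence of sets of natural numbers, continued by empty sets. -/
def natFamily {N : ℕ} (S : Fin n → Finset (Fin N)) (i : ℕ) : Finset ℕ :=
  if hi : i < n then (S ⟨i, hi⟩).map Fin.valEmbedding else ∅

theorem natFamily_val {N : ℕ} (S : Fin n → Finset (Fin N)) (i : Fin n) :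
    natFamily S i = (S i).map Fin.valEmbedding := by
  simp [natFamily]

theorem mem_natFamily {N j : ℕ} {S : Fin n → Finset (Fin N)} :
    j ∈ natFamily S i ↔ ∃ (hi : i < n) (hj : j < N), (⟨j, hj⟩ : Fin N) ∈ S ⟨i, hi⟩ := by
  by_cases hi : i < n
  · simp [natFamily, hi, Fin.exists_iff]
  · simp [natFamily, hi]

theorem ctx_input {N : ℕ} (S : Fin n → Finset (Fin N)) (ω : ℕ → Bool) (K B : ℕ) :
    Ctx (natFamily S) (1 + (B + 1) * (n + N)) n N K B
      ((((input S ω).setReg Reg.one 1).setReg Reg.maxSize K).setReg Reg.maxPrice B) where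
  numSets := by simp [input]
  numElems := by simp [input]
  one := by simp
  zero := by simp [input]
  maxSize := by simp
  maxPrice := by simp
  incidence i j := by simp [input, mem_natFamily]
  subset i j hj := by
    obtain ⟨-, hj, -⟩ := mem_natFamily.1 hj
    exact mem_range.2 hj
  eq_empty i hi := dif_neg hi.not_gt
  numSets_le := by nlinarith
  numElems_le := by nlinarith
  prices_lt := by nlinarith

/-- A polynomial bound on the running time of the algorithm: no loop takes more than
`1 + (B + 1) * (n + N)` rounds, which is one more than the sum of the prices can be. -/
noncomputable def packingTime (B : ℕ) : Polynomial ℕ :=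
  (packing (2 * (B + 1)) B).time (1 + Polynomial.C (B + 1) * Polynomial.X)

theorem eval_packingTime (B x : ℕ) :
    (packingTime B).eval x = (packing (2 * (B + 1)) B).time (1 + (B + 1) * x) := by
  rw [packingTime, ← Polynomial.coe_evalRingHom, Cmd.map_time]
  simp

theorem exists_run_packing {N : ℕ} (B : ℕ) (S : Fin n → Finset (Fin N)) :
    ∃ (a : Alloc ℕ ℕ) (s : State), a.NearOptimal (natFamily S) (2 * (B + 1)) B (range N) ∧
      Written a (range N) s ∧
      ∀ ω, run (packing (2 * (B + 1)) B) (input S ω) ((packingTime B).eval (n + N)) =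
        ⟨[], { s with coins := ω }⟩ := by
  obtain ⟨s, ⟨a, ha, hs⟩, hrun⟩ :=
    (wp_packing (ctx_input S (fun _ => false) _ B) fun a ha => by
      ext
      simp [input, ha]).run
  rw [← eval_packingTime] at hrun
  exact ⟨a, s, ha, hs, hrun⟩

section Output

variable {a : Alloc ℕ ℕ} {S : Fin n → Finset (Fin N)}

theorem map_selected (hs : Written a (range N) s) (ha : a.Valid (natFamily S)) :
    (selected n s).map Fin.valEmbedding = a.winners (range N) := by
  ext i
  simp only [selected, mem_map, mem_filter, mem_univ, true_and, hs.selected,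
    Fin.valEmbedding_apply]
  refine ⟨fun ⟨_, h, hi⟩ => hi ▸ h, fun h => ?_⟩
  obtain ⟨j, hj, rfl⟩ := mem_image.1 h
  obtain ⟨hi, -⟩ := mem_natFamily.1 (ha j (mem_filter.1 hj).2)
  exact ⟨⟨_, hi⟩, h, rfl⟩

theorem map_part (hs : Written a (range N) s) (ha : a.Valid (natFamily S)) :
    (part N s i).map Fin.valEmbedding = a.part (natFamily S) i := by
  ext j
  simp only [part, mem_map, mem_filter, mem_univ, true_and, hs.part, Fin.valEmbedding_apply,
    ha.mem_part]
  refine ⟨fun ⟨_, h, hj⟩ => hj ▸ h.2, fun h => ?_⟩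
  obtain ⟨-, hj, -⟩ := mem_natFamily.1 (ha j h.1)
  exact ⟨⟨j, hj⟩, ⟨mem_range.2 hj, h⟩, rfl⟩

theorem isPartialPacking_of_written (hK : 0 < K) (hs : Written a (range N) s)
    (ha : a.NearOptimal (natFamily S) K B (range N)) :
    IsPartialPacking S (1 / K) (selected n s) fun i => part N s i := by
  refine ⟨fun i hi => ⟨?_, ?_⟩, fun i _ i' _ hne => ?_⟩
  · rw [← map_subset_map (f := Fin.valEmbedding), map_part hs ha.valid, ← natFamily_val]
    exact filter_subset _ _
  · have hle := ha.card_le i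
      (by simpa [map_selected hs ha.valid] using mem_map_of_mem Fin.valEmbedding hi)
    rw [← map_part hs ha.valid, natFamily_val, card_map, card_map] at hle
    rw [one_div, inv_mul_le_iff₀ (by exact_mod_cast hK)]
    exact_mod_cast hle
  · rw [Function.onFun, ← disjoint_map Fin.valEmbedding, map_part hs ha.valid, map_part hs ha.valid]
    refine disjoint_left.2 fun j hj hj' => hne (Fin.ext ?_)
    exact (Alloc.mem_part.1 hj).2.2.symm.trans (Alloc.mem_part.1 hj').2.2

theorem mul_card_le_card_selected (hs : Written a (range N) s)
    (ha : a.NearOptimal (natFamily S) K B (range N)) {I : Finset (Fin n)}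
    (hne : ∀ i ∈ I, (S i).Nonempty) (hdisj : (I : Set (Fin n)).PairwiseDisjoint S) :
    B * #I ≤ (B + 2) * #(selected n s) := by
  have hle := ha.mul_card_le (I.map Fin.valEmbedding) ?_ ?_
  · rwa [← map_selected hs ha.valid, card_map, card_map] at hle
  · simpa [natFamily_val] using hne
  · rw [coe_map, Fin.valEmbedding.injective.injOn.pairwiseDisjoint_image]
    intro i hi i' hi' hii'
    simpa [Function.onFun, natFamily_val] using hdisj hi hi' hii'

end Output

theorem one_sub_mul_le {δ b m c : ℝ} (hδ : 0 < δ) (hb : 2 / δ < b) (hm : 0 ≤ m)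
    (h : b * m ≤ (b + 2) * c) : (1 - δ) * m ≤ c := by
  rw [div_lt_iff₀ hδ] at hb
  obtain hle | hlt := le_total m c
  · nlinarith
  · have hb0 : 0 < b := pos_of_mul_pos_left (two_pos.trans hb) hδ.le
    exact le_of_mul_le_mul_left (by nlinarith) hb0

end SetPacking

theorem theorem3_general (δ : ℝ) (hδ : 0 < δ) :
    ∃ ε : ℝ, 0 < ε ∧ ∃ (P : RAM.Cmd) (p : Polynomial ℕ),
      ∀ (n N : ℕ) (S : Fin n → Finset (Fin N)),
        ∃ (T : Finset (Fin n)) (A : Fin n → Finset (Fin N)),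
          (∀ ω : ℕ → Bool,
            (RAM.run P (SetPacking.input S ω) (p.eval (n + N))).code = [] ∧
            SetPacking.selected n (SetPacking.final P S (p.eval (n + N)) ω) = T ∧
            (fun i : Fin n => SetPacking.part N (SetPacking.final P S (p.eval (n + N)) ω) i) = A) ∧
          SetPacking.IsPartialPacking S ε T A ∧
          ∀ I : Finset (Fin n), (∀ i ∈ I, (S i).Nonempty) →
            (I : Set (Fin n)).PairwiseDisjoint S → (1 - δ) * (I.card : ℝ) ≤ (T.card : ℝ) := by
  obtain ⟨B, hB⟩ := exists_nat_gt (2 / δ)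
  refine ⟨1 / (2 * (B + 1) : ℕ), by positivity, SetPacking.packing (2 * (B + 1)) B,
    SetPacking.packingTime B, fun n N S => ?_⟩
  obtain ⟨a, s, ha, hs, hrun⟩ := SetPacking.exists_run_packing B S
  refine ⟨SetPacking.selected n s, fun i => SetPacking.part N s i, fun ω => ?_,
    SetPacking.isPartialPacking_of_written (by positivity) hs ha, fun I hne hdisj => ?_⟩
  · rw [SetPacking.final, hrun]
    exact ⟨rfl, rfl, rfl⟩
  · refine SetPacking.one_sub_mul_le hδ hB (Nat.cast_nonneg _) ?_
    exact_mod_cast SetPacking.mul_card_le_card_selected hs ha hne hdisj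

theorem theorem3 (δ : ℝ) (hδ : 0 < δ) :
    ∃ ε : ℝ, 0 < ε ∧ ∃ (P : RAM.Cmd) (p : Polynomial ℕ),
      ∀ (n N : ℕ) (S : Fin n → Finset (Fin N)),
        -- every run halts in polynomial time with a feasible output
        (∀ ω : ℕ → Bool,
          (RAM.run P (SetPacking.input S ω) (p.eval (n + N))).code = [] ∧
          SetPacking.IsPartialPacking S ε
            (SetPacking.selected n (SetPacking.final P S (p.eval (n + N)) ω))
            (fun i => SetPacking.part N (SetPacking.final P S (p.eval (n + N)) ω) i)) ∧
        -- the number of selected sets is large, with constant probability and in expectation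
        ∀ m : ℕ, SetPacking.HasPartition S m →
          2 / 3 ≤ RAM.fairCoins.real {ω : ℕ → Bool | (1 - δ) * (m : ℝ) ≤
            ((SetPacking.selected n (SetPacking.final P S (p.eval (n + N)) ω)).card : ℝ)} ∧
          (1 - δ) * (m : ℝ) ≤ ∫ ω : ℕ → Bool,
            ((SetPacking.selected n (SetPacking.final P S (p.eval (n + N)) ω)).card : ℝ)
              ∂(RAM.fairCoins) := by
  obtain ⟨ε, hε, P, p, h⟩ := theorem3_general δ hδ
  refine ⟨ε, hε, P, p, fun n N S => ?_⟩
  obtain ⟨T, A, hrun, hpacking, hcard⟩ := h n N S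
  refine ⟨fun ω => ⟨(hrun ω).1, (hrun ω).2.1 ▸ (hrun ω).2.2 ▸ hpacking⟩, ?_⟩
  rintro _ ⟨I, rfl, hne, hdisj, -⟩
  have hlarge := hcard I hne hdisj
  constructor
  · simp only [(hrun _).2.1, hlarge, Set.ofPred_true, probReal_univ]
    norm_num
  · simpa only [(hrun _).2.1, integral_const, probReal_univ, one_smul] using hlarge
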